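/- **Setting.** For $S\ge 1$ let $\mathcal M_S$ be the set of probability vectors of length $S$ and $L_1(P,Q)=\sum_{i=1}^S|p_i-q_i|$. Let $Q\in\mathcal M_S$ be known and $P\in\mathcal M_S$ unknown, and let $n>1$. One observes independent counts $X_{i,1},X_{i,2}\sim\mathsf{Poi}(np_i)$, $1\le i\le S$; put $\hat p_{i,j}=X_{i,j}/n$. We write $a\wedge b=\min\{a,b\}$ and $a\vee b=\max\{a,b\}$, and $\ln$ is the natural logarithm. **Estimator.** For constants $c_1,c_2,c_3>0$ with $c_3<c_1$ and $c_2<c_1$, let $$U(q)=\begin{cases}[0,\tfrac{2c_1\ln n}{n}], & q\le \tfrac{c_1\ln n}{n},\\ \big[q-\sqrt{\tfrac{c_1q\ln n}{n}},\,q+\sqrt{\tfrac{c_1q\ln n}{n}}\big], & q>\tfrac{c_1\ln n}{n},\end{cases}\qquad U_1(q)=\begin{cases}[0,\tfrac{(c_1+c_3)\ln n}{n}], & q\le \tfrac{c_1\ln n}{n},\\ \big[q-\sqrt{\tfrac{c_3q\ln n}{n}},\,q+\sqrt{\tfrac{c_3q\ln n}{n}}\big], & q>\tfrac{c_1\ln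 n}{n}.\end{cases}$$ Let $K=\lfloor c_2\ln n\rfloor$, and let $P_K(x;q)=\sum_{j\le K}a_jx^j$ be the best uniform approximation of $x\mapsto|x-q|$ on $U(q)$ by polynomials of degree at most $K$. Let $\tilde P_K(\hat p;q)=\sum_{j\le K}a_j\prod_{k=0}^{j-1}(\hat p-\tfrac kn)$ be the unbiased estimate of $P_K(p;q)$ from $n\hat p\sim\mathsf{Poi}(np)$. Writing $x>A$ (resp. $x<A$) for "$x>y$ (resp. $x<y$) for all $y\in A$", put $$\tilde L_1=\sum_{i=1}^S\Big[(\hat p_{i,2}-q_i)\mathbf 1(\hat p_{i,1}>U_1(q_i))+(q_i-\hat p_{i,2})\mathbf 1(\hat p_{i,1}<U_1(q_i))+\tilde P_K(\hat p_{i,2};q_i)\mathbf 1(\hat p_{i,1}\in U_1(q_i))\Big]$$ and $\hat L^{(1)}=0\vee(\tilde L_1\wedge 2)$. **Theorem.** 1. For all $\epsilon>0$ and $\beta>0$ there are constants $c_1,c_2,c_3$ as above and $C>0$, depending only on $\epsilon$ and $\beta$, such that for all $n>1$, $S\ge1$ and $Q\in\mathcal M_S$, $$\sup_{P\in\mathcal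 M_S}\mathbb E_P\big|\hat L^{(1)}-L_1(P,Q)\big|^2\le C\left(\Big(\sum_{i=1}^S q_i\wedge\sqrt{\tfrac{q_i}{n\ln n}}\Big)^2+\frac{\ln n}{n^{1-\epsilon}}+\frac{S}{n^\beta}\right).$$ 2. For all $a,b>0$ there are constants $c_1,c_2,c_3$ as above and $C>0$, depending only on $a$ and $b$, such that for all $n>1$, $S\ge1$ and $Q\in\mathcal M_S$ with $\ln S\le a\ln n$ and $\ln n\le b\ln\big(\sum_{i=1}^S\sqrt{q_i}\wedge q_i\sqrt{n\ln n}\big)$, $$\sup_{P\in\mathcal M_S}\mathbb E_P\big|\hat L^{(1)}-L_1(P,Q)\big|^2\le C\Big(\sum_{i=1}^S q_i\wedge\sqrt{\tfrac{q_i}{n\ln n}}\Big)^2.$$ 3. For every $b>0$ there are constants $c_1,c_2,c_3$ as above and $C>0$, depending only on $b$, such that for all $n>1$ and $S\ge1$ with $\ln n\le b\ln S$, $$\sup_{P,Q\in\mathcal M_S}\mathbb E_P\big|\hat L^{(1)}-L_1(P,Q)\big|^2\le C\,\frac{S}{n\ln n}.$$ -/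

import Mathlib

namespace L1Known

open MeasureTheory ProbabilityTheory

noncomputable section

/-- The `L₁` distance between two vectors indexed by `Fin S`. -/
def L1 {S : ℕ} (P Q : Fin S → ℝ) : ℝ := ∑ i, |P i - Q i|

/-! ### Uncertainty sets -/

/-- The uncertainty set `U(q; c₁)`. -/
def U (c₁ n q : ℝ) : Set ℝ :=
  if q ≤ c₁ * Real.log n / n then Set.Icc 0 (2 * c₁ * Real.log n / n)
  else Set.Icc (q - √(c₁ * q * Real.log n / n)) (q + √(c₁ * q * Real.log n / n))

/-- The (smaller) classification set `U₁(q)`. -/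
def U₁ (c₁ c₃ n q : ℝ) : Set ℝ :=
  if q ≤ c₁ * Real.log n / n then Set.Icc 0 ((c₁ + c₃) * Real.log n / n)
  else Set.Icc (q - √(c₃ * q * Real.log n / n)) (q + √(c₃ * q * Real.log n / n))

lemma isCompact_U (c₁ n q : ℝ) : IsCompact (U c₁ n q) := by
  unfold U; split_ifs <;> exact isCompact_Icc

/-! ### Best polynomial approximation -/

/-- The uniform distance on `s` between `f` and the polynomial `P`. -/
def supDist (f : ℝ → ℝ) (s : Set ℝ) (P : Polynomial ℝ) : ℝ := ⨆ z : s, |f z - P.eval (z : ℝ)|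

/-- `P` is a best uniform approximation of `f` on `s` among the polynomials of degree at most
`K`. -/
def IsBestApprox (f : ℝ → ℝ) (s : Set ℝ) (K : ℕ) (P : Polynomial ℝ) : Prop :=
  P.natDegree ≤ K ∧ ∀ R : Polynomial ℝ, R.natDegree ≤ K → supDist f s P ≤ supDist f s R

theorem exists_isBestApprox {f : ℝ → ℝ} {s : Set ℝ} (hf : ContinuousOn f s) (hs : IsCompact s)
    (K : ℕ) : ∃ P, IsBestApprox f s K P := by
  have : CompactSpace s := isCompact_iff_compactSpace.mp hs
  let F : C(s, ℝ) := ⟨fun z => f z, hf.domRestrict⟩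
  let T : Polynomial ℝ →ₗ[ℝ] C(s, ℝ) := (Polynomial.toContinuousMapOnAlgHom s).toLinearMap
  let V : Submodule ℝ C(s, ℝ) := (Polynomial.degreeLT ℝ (K + 1)).map T
  have : FiniteDimensional ℝ (Polynomial.degreeLT ℝ (K + 1)) :=
    Module.Finite.equiv (Polynomial.degreeLTEquiv ℝ (K + 1)).symm
  have : FiniteDimensional ℝ V := by infer_instance
  have : ProperSpace V := FiniteDimensional.proper_real V
  have hd : ∀ P : Polynomial ℝ, supDist f s P = ‖F - T P‖ := by
    intro P
    rw [ContinuousMap.norm_eq_iSup_norm]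
    rfl
  have hmem : ∀ P : Polynomial ℝ, P.natDegree ≤ K ↔ P ∈ Polynomial.degreeLT ℝ (K + 1) := by
    intro P
    rw [Polynomial.mem_degreeLT, Polynomial.degree_lt_iff_coeff_zero,
      Polynomial.natDegree_le_iff_coeff_eq_zero]
    exact Iff.rfl
  obtain ⟨v, hv⟩ : ∃ v : V, ∀ w : V, ‖F - (v : C(s, ℝ))‖ ≤ ‖F - (w : C(s, ℝ))‖ := by
    refine Continuous.exists_forall_le' (f := fun w : V => ‖F - (w : C(s, ℝ))‖) (by fun_prop) 0 ?_
    have h1 : ∀ᶠ w : V in Filter.cocompact V, 2 * ‖F‖ ≤ ‖w‖ :=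
      (tendsto_norm_cocompact_atTop (E := V)).eventually_ge_atTop _
    filter_upwards [h1] with w hw
    have h2 : ‖(w : C(s, ℝ))‖ ≤ ‖F‖ + ‖F - (w : C(s, ℝ))‖ := by
      simpa using norm_sub_le F (F - (w : C(s, ℝ)))
    have h3 : ‖w‖ = ‖(w : C(s, ℝ))‖ := rfl
    simp only [ZeroMemClass.coe_zero, sub_zero]
    linarith
  obtain ⟨P, hP, hPv⟩ := v.2
  refine ⟨P, (hmem P).2 hP, fun R hR => ?_⟩
  rw [hd, hd, hPv]
  exact hv ⟨T R, Submodule.mem_map_of_mem ((hmem R).1 hR)⟩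

open Classical in
/-- The best uniform approximation of `f` on `s` of degree at most `K`; it exists for continuous
`f` and compact `s` by `exists_isBestApprox`. -/
def bestApprox (f : ℝ → ℝ) (s : Set ℝ) (K : ℕ) : Polynomial ℝ :=
  if h : ∃ P, IsBestApprox f s K P then h.choose else 0

theorem isBestApprox_bestApprox {f : ℝ → ℝ} {s : Set ℝ} (hf : ContinuousOn f s)
    (hs : IsCompact s) (K : ℕ) : IsBestApprox f s K (bestApprox f s K) := by
  have h := exists_isBestApprox hf hs K
  rw [bestApprox, dif_pos h]
  exact h.choose_spec

/-- The degree `K = c₂ ln n`, rounded down. -/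
def deg (c₂ n : ℝ) : ℕ := ⌊c₂ * Real.log n⌋₊

/-- `P_K(x; q)`, the best approximation of `x ↦ |x - q|` on `U(q; c₁)` of degree `K = c₂ ln n`. -/
def approxPoly (c₁ c₂ n q : ℝ) : Polynomial ℝ :=
  bestApprox (fun x => |x - q|) (U c₁ n q) (deg c₂ n)

theorem isBestApprox_approxPoly (c₁ c₂ n q : ℝ) :
    IsBestApprox (fun x => |x - q|) (U c₁ n q) (deg c₂ n) (approxPoly c₁ c₂ n q) :=
  isBestApprox_bestApprox (by fun_prop) (isCompact_U c₁ n q) _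

/-! ### The unbiased estimate of a polynomial in the Poisson model -/

/-- The unbiased estimate of `P(p) = ∑ aⱼ pʲ` from `n p̂ ∼ Poi(n p)`, namely
`∑ aⱼ ∏_{k < j} (p̂ - k / n)`; see `unbiased_spec` for the unbiasedness. -/
def unbiased (n : ℝ) (P : Polynomial ℝ) (phat : ℝ) : ℝ :=
  P.sum fun j a => a * ∏ k ∈ Finset.range j, (phat - k / n)

lemma hasSum_descFactorial (r : ℝ) (j : ℕ) :
    HasSum (fun x : ℕ => Real.exp (-r) * r ^ x / x.factorial * (x.descFactorial j : ℝ))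
      (r ^ j) := by
  have hinj : Function.Injective (fun m : ℕ => m + j) := add_left_injective j
  rw [← hinj.hasSum_iff]
  · have h := ((NormedSpace.expSeries_div_hasSum_exp (𝔸 := ℝ) r).mul_left (Real.exp (-r))).mul_right
      (r ^ j)
    rw [← Real.exp_eq_exp_ℝ, ← Real.exp_add, neg_add_cancel, Real.exp_zero, one_mul] at h
    refine Eq.mpr (congrArg (fun g : ℕ → ℝ => HasSum g (r ^ j)) (funext fun m => ?_)) h
    have h1 : ((m + j).factorial : ℝ) = m.factorial * ((m + j).descFactorial j : ℝ) := by
      have := Nat.factorial_mul_descFactorial (Nat.le_add_left j m)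
      rw [Nat.add_sub_cancel] at this
      exact_mod_cast this.symm
    have h2 : ((m + j).descFactorial j : ℝ) ≠ 0 := by
      have := Nat.descFactorial_pos.2 (Nat.le_add_left j m)
      positivity
    have h3 : (m.factorial : ℝ) ≠ 0 := by positivity
    simp only [Function.comp]
    rw [h1]
    field_simp
    ring
  · intro x hx
    have : x < j := by
      by_contra hlt
      exact hx ⟨x - j, by simp only; omega⟩
    simp [Nat.descFactorial_eq_zero_iff_lt.2 this]

theorem unbiased_spec {n p : ℝ} (hn : 0 < n) (hp : 0 ≤ p) (P : Polynomial ℝ) :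
    Integrable (fun x : ℕ => unbiased n P (x / n)) (poissonMeasure (n * p).toNNReal) ∧
      ∫ x : ℕ, unbiased n P (x / n) ∂(poissonMeasure (n * p).toNNReal) = P.eval p := by
  have hr : (((n * p).toNNReal : NNReal) : ℝ) = n * p := Real.coe_toNNReal _ (by positivity)
  have hprod : ∀ j x : ℕ, ∏ k ∈ Finset.range j, ((x : ℝ) / n - k / n)
      = (x.descFactorial j : ℝ) * (n ^ j)⁻¹ := by
    intro j x
    rw [← descPochhammer_eval_eq_descFactorial, descPochhammer_eval_eq_prod_range]
    simp_rw [← sub_div]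
    rw [Finset.prod_div_distrib, Finset.prod_const, Finset.card_range, div_eq_mul_inv]
  have hsum : ∀ j : ℕ, HasSum (fun x : ℕ => Real.exp (-(n * p)) * (n * p) ^ x / x.factorial *
      ∏ k ∈ Finset.range j, ((x : ℝ) / n - k / n)) (p ^ j) := by
    intro j
    have h := (hasSum_descFactorial (n * p) j).mul_right ((n ^ j)⁻¹)
    have h2 : (n * p) ^ j * (n ^ j)⁻¹ = p ^ j := by
      rw [mul_pow]; field_simp
    rw [h2] at h
    simpa only [hprod, mul_assoc] using h
  have hint : ∀ j : ℕ, Integrable (fun x : ℕ => ∏ k ∈ Finset.range j, ((x : ℝ) / n - k / n))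
      (poissonMeasure (n * p).toNNReal) := by
    intro j
    rw [integrable_poissonMeasure_iff, hr]
    refine (hsum j).summable.congr fun x => ?_
    rw [Real.norm_of_nonneg]
    rw [hprod]
    positivity
  have hval : ∀ j : ℕ, ∫ x : ℕ, ∏ k ∈ Finset.range j, ((x : ℝ) / n - k / n)
      ∂(poissonMeasure (n * p).toNNReal) = p ^ j := by
    intro j
    rw [integral_poissonMeasure, hr]
    exact (hsum j).tsum_eq
  simp only [unbiased, Polynomial.sum]
  refine ⟨integrable_finsetSum _ fun j _ => (hint j).const_mul _, ?_⟩
  rw [integral_finsetSum _ fun j _ => (hint j).const_mul _, Polynomial.eval_eq_sum,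
    Polynomial.sum]
  refine Finset.sum_congr rfl fun j _ => ?_
  rw [integral_const_mul, hval]

/-! ### The estimator and its risk -/

open Classical in
/-- The untruncated estimator `L̃₁` computed from the two halves `x`, `y` of the sample (vectors of
counts): the first half classifies the regimes, the second half is used for the estimation. -/
def preEstimator {S : ℕ} (c₁ c₂ c₃ n : ℝ) (Q : Fin S → ℝ) (x y : Fin S → ℕ) : ℝ :=
  ∑ i, ((if ∀ u ∈ U₁ c₁ c₃ n (Q i), u < x i / n then y i / n - Q i else 0)
      + (if ∀ u ∈ U₁ c₁ c₃ n (Q i), x i / n < u then Q i - y i / n else 0)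
      + (if (x i / n : ℝ) ∈ U₁ c₁ c₃ n (Q i) then
          unbiased n (approxPoly c₁ c₂ n (Q i)) (y i / n) else 0))

/-- The estimator `L̂⁽¹⁾ = 0 ∨ (L̃₁ ∧ 2)`. -/
def estimator {S : ℕ} (c₁ c₂ c₃ n : ℝ) (Q : Fin S → ℝ) (x y : Fin S → ℕ) : ℝ :=
  max 0 (min (preEstimator c₁ c₂ c₃ n Q x y) 2)

/-- The law of one half of the sample: independent coordinates `Xᵢ ∼ Poi(n pᵢ)`. -/
def poissonSample {S : ℕ} (n : ℝ) (P : Fin S → ℝ) : Measure (Fin S → ℕ) :=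
  Measure.pi fun i => poissonMeasure (n * P i).toNNReal

instance {S : ℕ} (n : ℝ) (P : Fin S → ℝ) : IsProbabilityMeasure (poissonSample n P) := by
  unfold poissonSample; infer_instance

/-- The mean squared error `E_P |L̂⁽¹⁾ - L₁(P, Q)|²`, the two halves of the sample being
independent. -/
def risk {S : ℕ} (c₁ c₂ c₃ n : ℝ) (Q P : Fin S → ℝ) : ℝ :=
  ∫ z : (Fin S → ℕ) × (Fin S → ℕ), |estimator c₁ c₂ c₃ n Q z.1 z.2 - L1 P Q| ^ 2
    ∂((poissonSample n P).prod (poissonSample n P))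

/-- The expectation defining `risk` is that of a bounded, integrable random variable. -/
lemma integrable_risk {S : ℕ} (c₁ c₂ c₃ n : ℝ) (Q P : Fin S → ℝ) :
    Integrable (fun z : (Fin S → ℕ) × (Fin S → ℕ) =>
      |estimator c₁ c₂ c₃ n Q z.1 z.2 - L1 P Q| ^ 2)
      ((poissonSample n P).prod (poissonSample n P)) := by
  refine Integrable.of_bound (C := (2 + |L1 P Q|) ^ 2)
    (Measurable.of_discrete).aestronglyMeasurable (Filter.Eventually.of_forall fun z => ?_)
  rw [norm_pow, Real.norm_eq_abs, abs_abs]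
  have h0 : 0 ≤ estimator c₁ c₂ c₃ n Q z.1 z.2 := le_max_left _ _
  have h2 : estimator c₁ c₂ c₃ n Q z.1 z.2 ≤ 2 := max_le (by norm_num) (min_le_right _ _)
  gcongr
  calc |estimator c₁ c₂ c₃ n Q z.1 z.2 - L1 P Q|
      ≤ |estimator c₁ c₂ c₃ n Q z.1 z.2| + |L1 P Q| := abs_sub _ _
    _ ≤ 2 + |L1 P Q| := by rw [abs_of_nonneg h0]; linarith

end

end L1Known

/-! ### Jackson's theorem via a discrete positive kernel -/

namespace L1Known

open Finset Polynomial

/-! The first half of the sample only decides, for each symbol, which of three unbiased polynomial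
estimates is applied to the second half: that of `x - q`, of `q - x`, or of the best approximation
of `|x - q|` on `U`. If no symbol is misclassified, the conditional error is a sum of independent
terms and splits exactly into squared bias plus variance (`integral_sum_sub_sq`). Clipping to `[0,
2]` bounds the squared error by 4, so a misclassification costs at most four times its probability
(`risk_le_of_good`), and Chernoff bounds make this `O(S / n ^ β)` when `c₁ = 40 β`.

Bias. The linear branches have none. For the polynomial branch, Jackson's theorem with degree of
order `log n` is applied on an interval of length of order `√(q log n / n)`, or `log n / n` when `q`
is small; in the latter case the substitution `x = L t²` improves the error from `L / K` to `√(q L)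
/ K`. The logarithms combine to `q ∧ √(q / (n log n))` (`abs_sub_approxPoly_le_min`).

Variance. In the Poisson model the variance of the unbiased estimate of a polynomial is an explicit
sum of squares of its Taylor coefficients at `p` (`variance_unbiased`). Extremality of Chebyshev
polynomials bounds these by `4 ^ K` times the sup norm over a segment ending at `p`
(`abs_taylor_coeff_le_of_segment`). The resulting bound is proportional to `p + q`, hence sums over
the symbols without a factor `S`; the loss `32 ^ K` is at most `n ^ ε` for small `c₂`.

This gives the first claim (`exists_risk_le`). In the other two, the hypotheses bound a power of `n`
by the main term, which then absorbs the remaining terms once `ε` and `β` are chosen accordingly. -/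

/-- The squared modulus of the trigonometric polynomial `∑ αₖ e^{ikv}`, `k < m`. -/
noncomputable def trigSq (α : ℕ → ℝ) (m : ℕ) (v : ℝ) : ℝ :=
  ∑ j ∈ range m, ∑ k ∈ range m, α j * α k * Real.cos (((j : ℤ) - k : ℤ) * v)

lemma trigSq_eq_normSq (α : ℕ → ℝ) (m : ℕ) (v : ℝ) :
    trigSq α m v = Complex.normSq (∑ k ∈ range m, α k * Complex.exp (v * Complex.I) ^ k) := by
  have h : ∀ k : ℕ, Complex.exp (v * Complex.I) ^ k
      = Real.cos (k * v) + Real.sin (k * v) * Complex.I := by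
    intro k
    rw [← Complex.exp_nat_mul, ← mul_assoc, Complex.exp_mul_I]
    push_cast; rfl
  simp_rw [h]
  rw [Complex.normSq_apply]
  simp only [Complex.re_sum, Complex.im_sum, Complex.re_ofReal_mul, Complex.im_ofReal_mul,
    Complex.add_re, Complex.add_im, Complex.ofReal_re, Complex.ofReal_im, Complex.I_re,
    Complex.I_im, mul_zero, mul_one, add_zero, zero_add, sum_mul_sum, trigSq]
  rw [← sum_add_distrib]
  refine sum_congr rfl fun j _ => ?_
  rw [← sum_add_distrib]
  refine sum_congr rfl fun k _ => ?_
  push_cast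
  rw [sub_mul, Real.cos_sub]
  ring

lemma trigSq_nonneg (α : ℕ → ℝ) (m : ℕ) (v : ℝ) : 0 ≤ trigSq α m v := by
  rw [trigSq_eq_normSq]; exact Complex.normSq_nonneg _

lemma trigSq_neg (α : ℕ → ℝ) (m : ℕ) (v : ℝ) : trigSq α m (-v) = trigSq α m v := by
  simp [trigSq]

/-- Summation by parts: with `z = e^{iv}`, differencing the coefficients amounts to multiplication
by `1 - z` up to a unimodular factor, and `|1 - z|² = 2 - 2 cos v`. The vanishing end coefficients
remove the boundary terms. -/
lemma trigSq_diff {α : ℕ → ℝ} {m : ℕ} (h0 : α 0 = 0) (hm : α m = 0) (v : ℝ) :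
    trigSq (fun k => α (k + 1) - α k) m v = (2 - 2 * Real.cos v) * trigSq α m v := by
  set z := Complex.exp (v * Complex.I) with hz
  have hz1 : Complex.normSq z = 1 := by
    rw [Complex.normSq_eq_norm_sq, hz, Complex.norm_exp_ofReal_mul_I, one_pow]
  have h1 : z * ∑ k ∈ range m, ((α (k + 1) - α k : ℝ) : ℂ) * z ^ k
      = (1 - z) * ∑ k ∈ range m, (α k : ℂ) * z ^ k := by
    have h2 : ∑ k ∈ range m, (α (k + 1) : ℂ) * z ^ (k + 1) = ∑ k ∈ range m, (α k : ℂ) * z ^ k := by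
      have := sum_range_succ' (fun k => (α k : ℂ) * z ^ k) m
      rw [sum_range_succ, h0, hm] at this
      simpa using this.symm
    rw [sub_mul, one_mul]
    nth_rewrite 1 [← h2]
    rw [mul_sum, mul_sum, ← sum_sub_distrib]
    refine sum_congr rfl fun k _ => ?_
    push_cast; ring
  have h3 : Complex.normSq (1 - z) = 2 - 2 * Real.cos v := by
    rw [hz, Complex.normSq_apply, Complex.exp_mul_I]
    simp [Complex.cos_ofReal_re, Complex.sin_ofReal_re, Complex.cos_ofReal_im]
    nlinarith [Real.sin_sq_add_cos_sq v]
  have h4 := congrArg Complex.normSq h1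
  rw [map_mul, map_mul, hz1, one_mul, h3] at h4
  rw [trigSq_eq_normSq, trigSq_eq_normSq]
  exact h4

lemma sum_cos_equidistributed {N : ℕ} (d : ℤ) (hd : ¬ (N : ℤ) ∣ d) (θ : ℝ) :
    ∑ l ∈ range N, Real.cos (d * (θ + 2 * Real.pi * l / N)) = 0 := by
  rcases Nat.eq_zero_or_pos N with rfl | hN
  · simp
  have hN' : (N : ℂ) ≠ 0 := by exact_mod_cast hN.ne'
  set ζ := Complex.exp (2 * Real.pi * Complex.I / N)
  have hζ : IsPrimitiveRoot ζ N := Complex.isPrimitiveRoot_exp N hN.ne'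
  have h1 : ζ ^ d ≠ 1 := fun h => hd ((hζ.zpow_eq_one_iff_dvd d).1 h)
  have h2 : (ζ ^ d) ^ N = 1 := by
    rw [← zpow_natCast, ← zpow_mul, mul_comm, zpow_mul, zpow_natCast, hζ.pow_eq_one, one_zpow]
  have h3 : ∑ l ∈ range N, (ζ ^ d) ^ l = 0 := by
    rw [geom_sum_eq h1, h2, sub_self, zero_div]
  have h4 : ∀ l : ℕ, Real.cos (d * (θ + 2 * Real.pi * l / N))
      = (Complex.exp (d * θ * Complex.I) * (ζ ^ d) ^ l).re := by
    intro l
    rw [← Complex.exp_int_mul, ← Complex.exp_nat_mul, ← Complex.exp_add,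
      show (d * θ * Complex.I + l * (d * (2 * Real.pi * Complex.I / N)) : ℂ)
        = ((d * (θ + 2 * Real.pi * l / N) : ℝ) : ℂ) * Complex.I by push_cast; ring,
      Complex.exp_ofReal_mul_I_re]
  simp_rw [h4]
  rw [← Complex.re_sum, ← mul_sum, h3, mul_zero, Complex.zero_re]

/-- Discrete Parseval identity: the frequencies `j - k` are smaller than `N` in absolute value, so
only the diagonal survives averaging over `N` equally spaced nodes. -/
lemma sum_trigSq (α : ℕ → ℝ) {m N : ℕ} (hmN : m ≤ N) (θ : ℝ) :
    ∑ l ∈ range N, trigSq α m (θ + 2 * Real.pi * l / N) = N * ∑ k ∈ range m, α k ^ 2 := by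
  simp only [trigSq]
  rw [sum_comm, mul_sum]
  refine sum_congr rfl fun j hj => ?_
  rw [sum_comm, sum_eq_single j]
  · simp only [sub_self, Int.cast_zero, zero_mul, Real.cos_zero, sum_const, card_range,
      nsmul_eq_mul]
    ring
  · intro k hk hkj
    rw [← mul_sum, sum_cos_equidistributed, mul_zero]
    rw [mem_range] at hj hk
    intro hdvd
    have := Int.eq_zero_of_abs_lt_dvd hdvd (by rw [abs_lt]; omega)
    omega
  · exact fun h => absurd hj h

lemma sum_trigSq' (α : ℕ → ℝ) {m N : ℕ} (hmN : m ≤ N) (θ : ℝ) :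
    ∑ l ∈ range N, trigSq α m (θ - 2 * Real.pi * l / N) = N * ∑ k ∈ range m, α k ^ 2 := by
  rw [← sum_trigSq α hmN (-θ)]
  refine sum_congr rfl fun l _ => ?_
  rw [← trigSq_neg]; congr 1; ring

lemma sum_range_mul_sub_sq (M : ℝ) (n : ℕ) :
    ∑ k ∈ range n, ((k : ℝ) * (M - k)) ^ 2
      = M ^ 2 * (n * (n - 1) * (2 * n - 1) / 6) - 2 * M * (n * (n - 1) / 2) ^ 2
        + n * (n - 1) * (2 * n - 1) * (3 * n ^ 2 - 3 * n - 1) / 30 := by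
  induction n with
  | zero => simp
  | succ k ih => rw [sum_range_succ, ih]; push_cast; ring

/-- The theorem of Jackson for Lipschitz functions on `[-1, 1]`. -/
theorem exists_polynomial_near_of_lipschitz {f : ℝ → ℝ} {Λ : ℝ} (hΛ : 0 ≤ Λ)
    (hf : ∀ x ∈ Set.Icc (-1 : ℝ) 1, ∀ y ∈ Set.Icc (-1 : ℝ) 1, |f x - f y| ≤ Λ * |x - y|)
    {m : ℕ} (hm : 2 ≤ m) :
    ∃ R : ℝ[X], R.natDegree ≤ m ∧ ∀ t ∈ Set.Icc (-1 : ℝ) 1, |f t - R.eval t| ≤ 8 * Λ / m := by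
  -- A parabola vanishing at `0` and `m`: its energy `A` has order `m⁵` and the energy `B` of its
  -- differences order `m³`, so the kernel concentrates at scale `1 / m`.
  set α : ℕ → ℝ := fun k => k * (m - k) with hα
  set A := ∑ k ∈ range m, α k ^ 2 with hA
  set B := ∑ k ∈ range m, (α (k + 1) - α k) ^ 2 with hB
  have hm2 : (2 : ℝ) ≤ m := by exact_mod_cast hm
  have hA1 : (m : ℝ) ^ 5 / 60 ≤ A := by
    have h1 : A = m * (m ^ 4 - 1) / 30 := by rw [hA, hα, sum_range_mul_sub_sq]; ring
    have h2 : (2 : ℝ) ^ 4 ≤ (m : ℝ) ^ 4 := by gcongr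
    rw [h1]; nlinarith
  have hB1 : B ≤ m ^ 3 := by
    have : ∀ k ∈ range m, (α (k + 1) - α k) ^ 2 ≤ (m : ℝ) ^ 2 := by
      intro k hk
      have hk' : (k : ℝ) + 1 ≤ m := by exact_mod_cast mem_range.1 hk
      have hk0 : (0 : ℝ) ≤ k := by positivity
      rw [sq_le_sq, abs_of_nonneg (by positivity : (0 : ℝ) ≤ m), abs_le]
      simp only [hα]; push_cast
      constructor <;> nlinarith
    refine (sum_le_sum this).trans_eq ?_
    rw [sum_const, card_range, nsmul_eq_mul]; ring
  have hA0 : 0 < A := lt_of_lt_of_le (by positivity) hA1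
  have hm0 : (0 : ℝ) < m := by linarith
  set u : ℕ → ℝ := fun l => 2 * Real.pi * l / m with hu
  -- Symmetrizing in the node turns `cos (d (θ ∓ u))` into `cos (dθ) cos (du)`, a polynomial in `cos
  -- θ`. The approximant is the average of `f (cos u)` over the nodes with these nonnegative
  -- weights.
  set W : ℝ → ℕ → ℝ := fun θ l => (trigSq α m (θ - u l) + trigSq α m (θ + u l)) / 2 with hW
  have hW0 : ∀ θ l, 0 ≤ W θ l := fun θ l => by
    have := trigSq_nonneg α m (θ - u l); have := trigSq_nonneg α m (θ + u l)
    simp only [hW]; linarith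
  have hWsum : ∀ θ, ∑ l ∈ range m, W θ l = m * A := fun θ => by
    simp only [hW, hu]
    rw [← sum_div, sum_add_distrib, sum_trigSq _ le_rfl, sum_trigSq' _ le_rfl]; ring
  have hWsq : ∀ θ, ∑ l ∈ range m, W θ l * (Real.cos θ - Real.cos (u l)) ^ 2 ≤ m * B := by
    intro θ
    have h1 : ∑ l ∈ range m, (trigSq (fun k => α (k + 1) - α k) m (θ - u l)
        + trigSq (fun k => α (k + 1) - α k) m (θ + u l)) / 2 = m * B := by
      simp only [hu]
      rw [← sum_div, sum_add_distrib, sum_trigSq _ le_rfl, sum_trigSq' _ le_rfl]; ring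
    rw [← h1]
    refine sum_le_sum fun l _ => ?_
    have h0 : α 0 = 0 := by simp [hα]
    have hmm : α m = 0 := by simp [hα]
    rw [trigSq_diff h0 hmm, trigSq_diff h0 hmm]
    -- The right side is `|e^{iθ} - e^{iu}|²`, whose real part alone contributes the left side.
    have e1 : (Real.cos θ - Real.cos (u l)) ^ 2 ≤ 2 - 2 * Real.cos (θ - u l) := by
      rw [Real.cos_sub]
      nlinarith [sq_nonneg (Real.sin θ - Real.sin (u l)), Real.sin_sq_add_cos_sq θ,
        Real.sin_sq_add_cos_sq (u l)]
    have e2 : (Real.cos θ - Real.cos (u l)) ^ 2 ≤ 2 - 2 * Real.cos (θ + u l) := by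
      rw [Real.cos_add]
      nlinarith [sq_nonneg (Real.sin θ + Real.sin (u l)), Real.sin_sq_add_cos_sq θ,
        Real.sin_sq_add_cos_sq (u l)]
    have f1 := mul_le_mul_of_nonneg_right e1 (trigSq_nonneg α m (θ - u l))
    have f2 := mul_le_mul_of_nonneg_right e2 (trigSq_nonneg α m (θ + u l))
    simp only [hW]
    linarith
  set R : ℝ[X] := ∑ l ∈ range m, ∑ j ∈ range m, ∑ k ∈ range m,
    C (f (Real.cos (u l)) / (m * A) * (α j * α k * Real.cos (((j : ℤ) - k : ℤ) * u l)))
      * Chebyshev.T ℝ ((j : ℤ) - k) with hR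
  refine ⟨R, ?_, fun t ht => ?_⟩
  · refine natDegree_sum_le_of_forall_le _ _ fun l _ => natDegree_sum_le_of_forall_le _ _
      fun j hj => natDegree_sum_le_of_forall_le _ _ fun k hk => ?_
    refine (natDegree_C_mul_le _ _).trans ?_
    rw [Chebyshev.natDegree_T]
    rw [mem_range] at hj hk
    omega
  obtain ⟨θ, rfl⟩ : ∃ θ, t = Real.cos θ := ⟨Real.arccos t, (Real.cos_arccos ht.1 ht.2).symm⟩
  have hReval : R.eval (Real.cos θ) = ∑ l ∈ range m, f (Real.cos (u l)) * W θ l / (m * A) := by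
    simp only [hR, eval_finsetSum, eval_mul, eval_C, Chebyshev.T_real_cos]
    refine sum_congr rfl fun l _ => ?_
    simp only [hW, trigSq]
    generalize (m : ℝ) * A = c
    rw [← sum_add_distrib, sum_div, mul_sum, sum_div]
    refine sum_congr rfl fun j _ => ?_
    rw [← sum_add_distrib, sum_div, mul_sum, sum_div]
    refine sum_congr rfl fun k _ => ?_
    rw [mul_sub, mul_add, Real.cos_sub, Real.cos_add]
    ring
  have hfe : f (Real.cos θ) = ∑ l ∈ range m, f (Real.cos θ) * W θ l / (m * A) := by
    rw [← sum_div, ← mul_sum, hWsum]; field_simp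
  rw [hReval]
  conv_lhs => rw [hfe]
  rw [← sum_sub_distrib]
  have hterm : ∀ l ∈ range m, |f (Real.cos θ) * W θ l / (m * A)
      - f (Real.cos (u l)) * W θ l / (m * A)|
      ≤ (4 * Λ / m / (m * A)) * W θ l
        + (Λ * m / 16 / (m * A)) * (W θ l * (Real.cos θ - Real.cos (u l)) ^ 2) := by
    intro l _
    rw [← sub_div, ← sub_mul, abs_div, abs_mul, abs_of_nonneg (hW0 θ l),
      abs_of_pos (by positivity : 0 < m * A)]
    have h1 := hf _ (Real.cos_mem_Icc θ) _ (Real.cos_mem_Icc (u l))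
    set x := Real.cos θ - Real.cos (u l)
    -- AM-GM balanced at scale `1 / m`: since the mean of `x²` is at most `60 / m²`, the total is
    -- `(4 + 60 / 16) / m ≤ 8 / m`.
    have h2 : |x| ≤ 4 / m + m / 16 * x ^ 2 := by
      have h3 : 0 ≤ (4 / m) * (m / 8 * |x| - 1) ^ 2 := by positivity
      have h4 : (4 / m) * (m / 8 * |x| - 1) ^ 2 = m / 16 * |x| ^ 2 - |x| + 4 / m := by
        field_simp; ring
      rw [sq_abs] at h4
      linarith
    have h5 : |f (Real.cos θ) - f (Real.cos (u l))| ≤ Λ * (4 / m + m / 16 * x ^ 2) :=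
      h1.trans (mul_le_mul_of_nonneg_left h2 hΛ)
    calc |f (Real.cos θ) - f (Real.cos (u l))| * W θ l / (m * A)
        ≤ Λ * (4 / m + m / 16 * x ^ 2) * W θ l / (m * A) := by gcongr; exact hW0 θ l
      _ = _ := by ring
  refine (abs_sum_le_sum_abs _ _).trans ((sum_le_sum hterm).trans ?_)
  rw [sum_add_distrib, ← mul_sum, ← mul_sum, hWsum]
  have hBA : B / A ≤ 60 / m ^ 2 := by
    rw [div_le_div_iff₀ hA0 (by positivity)]
    nlinarith [mul_le_mul_of_nonneg_right hB1 (by positivity : (0 : ℝ) ≤ m ^ 2)]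
  calc _ ≤ 4 * Λ / m / (m * A) * (m * A) + Λ * m / 16 / (m * A) * (m * B) := by
        gcongr; exact hWsq θ
    _ = 4 * Λ / m + Λ * m / 16 * (B / A) := by field_simp
    _ ≤ 4 * Λ / m + Λ * m / 16 * (60 / m ^ 2) := by gcongr
    _ = (4 + 15 / 4) * (Λ / m) := by field_simp; ring
    _ ≤ 8 * (Λ / m) := by gcongr; norm_num
    _ = 8 * Λ / m := by ring

end L1Known

/-! ### Taylor coefficients of bounded polynomials -/

namespace L1Known

open Polynomial

lemma eval_two_chebyshev_T_le (n : ℕ) : (Chebyshev.T ℝ n).eval 2 ≤ 4 ^ n := by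
  induction n with
  | zero => simp
  | succ k ih =>
    have h1 := Chebyshev.one_le_eval_T_real (k - 1 : ℤ) (show (1 : ℝ) ≤ 2 by norm_num)
    have h2 := congrArg (eval 2) (Chebyshev.T_add_one ℝ (k : ℤ))
    simp only [eval_sub, eval_mul, eval_X, eval_ofNat] at h2
    push_cast
    rw [h2, pow_succ]
    linarith

lemma iterate_derivative_eval_eq_taylor_coeff (P : ℝ[X]) (r : ℝ) (i : ℕ) :
    (derivative^[i] P).eval r = i.factorial * (taylor r P).coeff i := by
  rw [taylor_coeff, ← factorial_smul_hasseDeriv]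
  simp

lemma taylor_one_coeff_le_chebyshev {n : ℕ} {P : ℝ[X]} (hdeg : P.natDegree ≤ n)
    (hP : ∀ x ∈ Set.Icc (-1 : ℝ) 1, |P.eval x| ≤ 1) (i : ℕ) :
    (taylor 1 P).coeff i ≤ (taylor 1 (Chebyshev.T ℝ n)).coeff i := by
  have h := Chebyshev.eval_iterate_derivative_le_of_forall_abs_le_one (k := i) (x := 1) le_rfl
    (natDegree_le_iff_degree_le.1 hdeg) hP
  rw [iterate_derivative_eval_eq_taylor_coeff, iterate_derivative_eval_eq_taylor_coeff] at h
  exact le_of_mul_le_mul_left h (by positivity)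

/-- The Taylor coefficients of `T_n` at `1` are nonnegative (compare with the zero polynomial) and
add up to `T_n(2)`, so each is at most `T_n(2)`. -/
lemma taylor_one_chebyshev_T_coeff_le (n i : ℕ) :
    (taylor 1 (Chebyshev.T ℝ n)).coeff i ≤ 4 ^ n := by
  have hnn : ∀ k, 0 ≤ (taylor 1 (Chebyshev.T ℝ n)).coeff k := fun k => by
    simpa using taylor_one_coeff_le_chebyshev (n := n) (P := 0) (by simp) (by simp) k
  refine le_trans ?_ (eval_two_chebyshev_T_le n)
  have h : (taylor 1 (Chebyshev.T ℝ n)).eval 1 = (Chebyshev.T ℝ n).eval 2 := by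
    rw [taylor_eval]; norm_num
  rw [← h, eval_eq_sum_range]
  simp only [one_pow, mul_one]
  by_cases hi : i ∈ Finset.range ((taylor 1 (Chebyshev.T ℝ n)).natDegree + 1)
  · exact Finset.single_le_sum (f := fun k => (taylor 1 (Chebyshev.T ℝ n)).coeff k)
      (fun k _ => hnn k) hi
  · rw [coeff_eq_zero_of_natDegree_lt (by simpa using hi)]
    exact Finset.sum_nonneg fun k _ => hnn k

lemma abs_taylor_one_coeff_le {n : ℕ} {P : ℝ[X]} {M : ℝ} (hM : 0 < M) (hdeg : P.natDegree ≤ n)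
    (hP : ∀ x ∈ Set.Icc (-1 : ℝ) 1, |P.eval x| ≤ M) (i : ℕ) :
    |(taylor 1 P).coeff i| ≤ M * 4 ^ n := by
  have key : ∀ c : ℝ, |c| = M⁻¹ → c * (taylor 1 P).coeff i ≤ 4 ^ n := by
    intro c hc
    have := taylor_one_coeff_le_chebyshev (P := C c * P) ((natDegree_C_mul_le _ _).trans hdeg)
      (fun x hx => by
        rw [eval_mul, eval_C, abs_mul, hc, inv_mul_le_iff₀ hM, mul_one]; exact hP x hx) i
    rw [taylor_mul, taylor_C, coeff_C_mul] at this
    exact this.trans (taylor_one_chebyshev_T_coeff_le n i)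
  have h1 := key M⁻¹ (abs_of_pos (inv_pos.2 hM))
  have h2 := key (-M⁻¹) (by rw [abs_neg]; exact abs_of_pos (inv_pos.2 hM))
  rw [neg_mul, ← mul_neg] at h2
  rw [inv_mul_le_iff₀ hM] at h1 h2
  exact abs_le'.2 ⟨h1, h2⟩

/-- The Taylor coefficients at an endpoint of a segment on which the polynomial is bounded. -/
theorem abs_taylor_coeff_le_of_segment {n : ℕ} {P : ℝ[X]} {M p w : ℝ} (hM : 0 < M)
    (hdeg : P.natDegree ≤ n) (hP : ∀ s ∈ Set.Icc (0 : ℝ) 1, |P.eval (p + w * s)| ≤ M) (i : ℕ) :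
    |(taylor p P).coeff i| * (|w| / 2) ^ i ≤ M * 4 ^ n := by
  -- The affine map sends `1` to `p` and `-1` to `p + w`; each derivative at the endpoint gains a
  -- factor `-w / 2`.
  set Q : ℝ[X] := P.comp (C p + C (w / 2) * (1 - X)) with hQ
  have hQdeg : Q.natDegree ≤ n := by
    refine natDegree_comp_le.trans ?_
    have : (C p + C (w / 2) * (1 - X) : ℝ[X]).natDegree ≤ 1 := by
      compute_degree
    calc _ ≤ P.natDegree * 1 := Nat.mul_le_mul_left _ this
      _ ≤ n := by simpa using hdeg
  have hQb : ∀ x ∈ Set.Icc (-1 : ℝ) 1, |Q.eval x| ≤ M := by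
    intro x hx
    have := hP ((1 - x) / 2) ⟨by linarith [hx.2], by linarith [hx.1]⟩
    have e : Q.eval x = P.eval (p + w * ((1 - x) / 2)) := by
      rw [hQ, eval_comp]
      simp only [eval_add, eval_mul, eval_sub, eval_C, eval_X, eval_one]
      ring_nf
    rw [e]; exact this
  have h := abs_taylor_one_coeff_le hM hQdeg hQb i
  have hT : taylor 1 Q = (taylor p P).comp (C (-(w / 2)) * X) := by
    rw [hQ, taylor_apply, taylor_apply, comp_assoc, comp_assoc]
    congr 1
    simp only [add_comp, mul_comp, sub_comp, C_comp, X_comp, one_comp, map_neg, C_1]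
    ring
  rw [hT, comp_C_mul_X_coeff, abs_mul, abs_pow, abs_neg, abs_div, abs_two] at h
  exact h

end L1Known

/-! ### Second moments of unbiased polynomial estimates -/

namespace L1Known

open MeasureTheory ProbabilityTheory Polynomial Finset

lemma add_descFactorial (m j k : ℕ) :
    (m + j).descFactorial k
      = ∑ i ∈ range (k + 1), k.choose i * j.descFactorial i * m.descFactorial (k - i) := by
  rw [Nat.descFactorial_eq_factorial_mul_choose, add_comm m j, Nat.add_choose_eq,
    Nat.sum_antidiagonal_eq_sum_range_succ_mk, mul_sum]
  refine sum_congr rfl fun i hi => ?_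
  rw [← Nat.choose_mul_factorial_mul_factorial (Nat.lt_succ_iff.1 (mem_range.1 hi)),
    Nat.descFactorial_eq_factorial_mul_choose j, Nat.descFactorial_eq_factorial_mul_choose m]
  ring

/-- Linearizes products of falling factorials, so that the mixed Poisson moments follow from the
factorial moments; it is Vandermonde's identity after writing `x = m + j`. -/
lemma descFactorial_mul_eq_sum (x j k : ℕ) :
    x.descFactorial j * x.descFactorial k
      = ∑ i ∈ range (k + 1),
          j.choose i * k.choose i * i.factorial * x.descFactorial (j + k - i) := by
  rcases lt_or_ge x j with hx | hx
  · rw [Nat.descFactorial_eq_zero_iff_lt.2 hx, zero_mul]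
    refine (sum_eq_zero fun i hi => ?_).symm
    rw [mem_range] at hi
    rw [Nat.descFactorial_eq_zero_iff_lt.2 (by omega : x < j + k - i), mul_zero]
  · obtain ⟨m, rfl⟩ := Nat.exists_eq_add_of_le' hx
    rw [add_descFactorial m j k, mul_sum]
    refine sum_congr rfl fun i hi => ?_
    rw [mem_range] at hi
    rw [← Nat.descFactorial_mul_descFactorial (by omega : j ≤ j + k - i), Nat.add_sub_cancel,
      show j + k - i - j = k - i by omega, Nat.descFactorial_eq_factorial_mul_choose j i]
    ring

lemma hasSum_descFactorial_mul (r : ℝ) {j k K : ℕ} (hk : k ≤ K) :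
    HasSum (fun x : ℕ => Real.exp (-r) * r ^ x / x.factorial *
        ((x.descFactorial j : ℝ) * x.descFactorial k))
      (∑ i ∈ range (K + 1), (j.choose i * k.choose i * i.factorial : ℝ) * r ^ (j + k - i)) := by
  have h : ∀ x : ℕ, (x.descFactorial j : ℝ) * x.descFactorial k
      = ∑ i ∈ range (K + 1),
          (j.choose i * k.choose i * i.factorial : ℝ) * x.descFactorial (j + k - i) := by
    intro x
    rw [← sum_subset (range_subset_range.2 (Nat.succ_le_succ hk))]
    · exact_mod_cast descFactorial_mul_eq_sum x j k
    · intro i _ hi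
      rw [mem_range, not_lt] at hi
      simp [Nat.choose_eq_zero_of_lt (by omega : k < i)]
  simp_rw [h, mul_sum]
  refine hasSum_sum fun i _ => ?_
  refine Eq.mpr (congrArg (fun g : ℕ → ℝ => HasSum g _) (funext fun x => ?_))
    ((hasSum_descFactorial r (j + k - i)).mul_left
      (j.choose i * k.choose i * i.factorial : ℝ))
  ring

lemma unbiased_eq_sum_descFactorial (n : ℝ) {P : ℝ[X]} {K : ℕ} (hP : P.natDegree ≤ K) (x : ℕ) :
    unbiased n P (x / n)
      = ∑ j ∈ range (K + 1), P.coeff j * ((x.descFactorial j : ℝ) * (n ^ j)⁻¹) := by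
  rw [unbiased, sum_over_range' _ (by simp) (K + 1) (Nat.lt_succ_of_le hP)]
  refine sum_congr rfl fun j _ => ?_
  rw [← descPochhammer_eval_eq_descFactorial, descPochhammer_eval_eq_prod_range]
  simp_rw [← sub_div]
  rw [Finset.prod_div_distrib, Finset.prod_const, Finset.card_range, div_eq_mul_inv]

lemma taylor_coeff_eq_sum {P : ℝ[X]} {K : ℕ} (hP : P.natDegree ≤ K) (p : ℝ) (i : ℕ) :
    (taylor p P).coeff i = ∑ j ∈ range (K + 1), P.coeff j * (j.choose i * p ^ (j - i)) := by
  rw [taylor_coeff, hasseDeriv_apply, sum_over_range' _ (by simp) (K + 1) (Nat.lt_succ_of_le hP),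
    eval_finsetSum]
  refine sum_congr rfl fun j _ => ?_
  rw [eval_monomial]; ring

/-- The second moment of the unbiased estimate of a polynomial in the Poisson model. -/
theorem hasSum_unbiased_sq {n : ℝ} (hn : 0 < n) (p : ℝ) {P : ℝ[X]} {K : ℕ}
    (hP : P.natDegree ≤ K) :
    HasSum (fun x : ℕ => Real.exp (-(n * p)) * (n * p) ^ x / x.factorial *
        unbiased n P (x / n) ^ 2)
      (∑ i ∈ range (K + 1), (p / n) ^ i * i.factorial * (taylor p P).coeff i ^ 2) := by
  have h1 : ∀ x : ℕ, Real.exp (-(n * p)) * (n * p) ^ x / x.factorial * unbiased n P (x / n) ^ 2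
      = ∑ j ∈ range (K + 1), ∑ k ∈ range (K + 1), P.coeff j * P.coeff k * (n ^ (j + k))⁻¹ *
        (Real.exp (-(n * p)) * (n * p) ^ x / x.factorial *
        ((x.descFactorial j : ℝ) * x.descFactorial k)) := by
    intro x
    rw [unbiased_eq_sum_descFactorial n hP, sq, sum_mul_sum, mul_sum]
    refine sum_congr rfl fun j _ => ?_
    rw [mul_sum]
    refine sum_congr rfl fun k _ => ?_
    rw [pow_add, mul_inv]; ring
  -- For fixed `i` the double sum over `j`, `k` is a product of two equal factors, each the `i`-th
  -- Taylor coefficient at `p`.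
  have h2 : ∑ i ∈ range (K + 1), (p / n) ^ i * i.factorial * (taylor p P).coeff i ^ 2
      = ∑ j ∈ range (K + 1), ∑ k ∈ range (K + 1), P.coeff j * P.coeff k * (n ^ (j + k))⁻¹ *
        ∑ i ∈ range (K + 1),
          (j.choose i * k.choose i * i.factorial : ℝ) * (n * p) ^ (j + k - i) := by
    simp_rw [taylor_coeff_eq_sum hP, sq, sum_mul_sum, mul_sum]
    rw [sum_comm]
    refine sum_congr rfl fun j _ => ?_
    rw [sum_comm]
    refine sum_congr rfl fun k _ => sum_congr rfl fun i _ => ?_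
    rcases lt_or_ge j i with hj | hj
    · simp [Nat.choose_eq_zero_of_lt hj]
    rcases lt_or_ge k i with hk | hk
    · simp [Nat.choose_eq_zero_of_lt hk]
    obtain ⟨a, rfl⟩ := Nat.exists_eq_add_of_le hj
    obtain ⟨b, rfl⟩ := Nat.exists_eq_add_of_le hk
    rw [show i + a + (i + b) - i = i + a + b by omega, Nat.add_sub_cancel_left,
      Nat.add_sub_cancel_left]
    rw [div_pow, show i + a + (i + b) = i + (i + a + b) by ring, pow_add n i, mul_pow]
    field_simp
    ring
  simp_rw [h1]
  rw [h2]
  refine hasSum_sum fun j _ => hasSum_sum fun k hk => ?_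
  exact (hasSum_descFactorial_mul _ (Nat.lt_succ_iff.1 (mem_range.1 hk))).mul_left _

variable {n p : ℝ} {P : ℝ[X]} {K : ℕ}

lemma integrable_unbiased_sq (hn : 0 < n) (hp : 0 ≤ p) (P : ℝ[X]) :
    Integrable (fun x : ℕ => unbiased n P (x / n) ^ 2) (poissonMeasure (n * p).toNNReal) := by
  rw [integrable_poissonMeasure_iff, Real.coe_toNNReal _ (by positivity)]
  refine (hasSum_unbiased_sq hn p (P := P) le_rfl).summable.congr fun x => ?_
  rw [Real.norm_of_nonneg (sq_nonneg _)]

lemma integral_unbiased_sq (hn : 0 < n) (hp : 0 ≤ p) (hP : P.natDegree ≤ K) :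
    ∫ x : ℕ, unbiased n P (x / n) ^ 2 ∂(poissonMeasure (n * p).toNNReal)
      = ∑ i ∈ range (K + 1), (p / n) ^ i * i.factorial * (taylor p P).coeff i ^ 2 := by
  rw [integral_poissonMeasure, Real.coe_toNNReal _ (by positivity)]
  exact (hasSum_unbiased_sq hn p hP).tsum_eq

lemma memLp_unbiased (hn : 0 < n) (hp : 0 ≤ p) (P : ℝ[X]) :
    MemLp (fun x : ℕ => unbiased n P (x / n)) 2 (poissonMeasure (n * p).toNNReal) :=
  (memLp_two_iff_integrable_sq Measurable.of_discrete.aestronglyMeasurable).2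
    (integrable_unbiased_sq hn hp P)

theorem variance_unbiased (hn : 0 < n) (hp : 0 ≤ p) (hP : P.natDegree ≤ K) :
    variance (fun x : ℕ => unbiased n P (x / n)) (poissonMeasure (n * p).toNNReal)
      = ∑ i ∈ range K, (p / n) ^ (i + 1) * (i + 1).factorial * (taylor p P).coeff (i + 1) ^ 2 := by
  rw [variance_eq_sub (memLp_unbiased hn hp P), (unbiased_spec hn hp P).2]
  have : ∫ x : ℕ, ((fun x : ℕ => unbiased n P (x / n)) ^ 2) x ∂(poissonMeasure (n * p).toNNReal)
      = _ := integral_unbiased_sq hn hp hP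
  rw [this, sum_range_succ', taylor_coeff_zero]
  simp

/-- With `(i + 1)! ≤ K ^ (i + 1)` and the endpoint bound, the terms are at most `ρ ^ (i + 1) * M ^ 2
* 16 ^ K`. As `ρ ≤ 1`, one factor `ρ` is kept, which preserves the proportionality to `p`; the
number of terms is absorbed by `K ≤ 2 ^ K`. -/
theorem variance_unbiased_le (hn : 0 < n) (hp : 0 ≤ p) (hP : P.natDegree ≤ K) {M w : ℝ}
    (hM : 0 < M) (hw : w ≠ 0)
    (hb : ∀ s ∈ Set.Icc (0 : ℝ) 1, |P.eval (p + w * s)| ≤ M)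
    (hρ : 4 * K * p / (n * w ^ 2) ≤ 1) :
    variance (fun x : ℕ => unbiased n P (x / n)) (poissonMeasure (n * p).toNNReal)
      ≤ 4 * K * p / (n * w ^ 2) * M ^ 2 * 32 ^ K := by
  set ρ := 4 * K * p / (n * w ^ 2) with hρd
  have hρ0 : 0 ≤ ρ := by positivity
  have hw' : 0 < |w| := abs_pos.2 hw
  have hterm : ∀ i ∈ range K, (p / n) ^ (i + 1) * (i + 1).factorial
      * (taylor p P).coeff (i + 1) ^ 2 ≤ ρ * M ^ 2 * 16 ^ K := by
    intro i hi
    have hiK : i + 1 ≤ K := mem_range.1 hi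
    have h1 : ((i + 1).factorial : ℝ) ≤ (K : ℝ) ^ (i + 1) := by
      exact_mod_cast (Nat.factorial_le_pow (i + 1)).trans (Nat.pow_le_pow_left hiK _)
    have h2 := abs_taylor_coeff_le_of_segment hM hP hb (i + 1)
    have h3 : (taylor p P).coeff (i + 1) ^ 2 ≤ (M * 4 ^ K / (|w| / 2) ^ (i + 1)) ^ 2 := by
      rw [← sq_abs]
      gcongr
      rw [le_div_iff₀ (by positivity)]
      exact h2
    calc _ ≤ (p / n) ^ (i + 1) * (K : ℝ) ^ (i + 1) * (M * 4 ^ K / (|w| / 2) ^ (i + 1)) ^ 2 := by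
          gcongr
      _ = ρ ^ (i + 1) * M ^ 2 * 16 ^ K := by
          have e : ρ = p / n * K / ((|w| / 2) ^ 2) := by
            rw [div_pow, sq_abs, hρd]; field_simp; ring
          have e2 : (16 : ℝ) ^ K = (4 ^ K) ^ 2 := by
            rw [← pow_mul, mul_comm, pow_mul]; norm_num
          rw [e, e2]
          generalize p / n = a
          generalize |w| / 2 = h
          ring
      _ ≤ ρ * M ^ 2 * 16 ^ K := by
          gcongr
          exact pow_le_of_le_one hρ0 hρ (Nat.succ_ne_zero i)
  rw [variance_unbiased hn hp hP]
  refine (sum_le_sum hterm).trans ?_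
  rw [sum_const, card_range, nsmul_eq_mul]
  have h2K : (K : ℝ) ≤ 2 ^ K := by exact_mod_cast Nat.lt_two_pow_self.le
  calc (K : ℝ) * (ρ * M ^ 2 * 16 ^ K) ≤ 2 ^ K * (ρ * M ^ 2 * 16 ^ K) := by gcongr
    _ = ρ * M ^ 2 * 32 ^ K := by
      rw [show (32 : ℝ) = 2 * 16 by norm_num, mul_pow]; ring

end L1Known

/-! ### Chernoff bounds for the Poisson distribution -/

namespace L1Known

open MeasureTheory ProbabilityTheory

lemma hasSum_exp_mul_poisson (r s : ℝ) :
    HasSum (fun x : ℕ => Real.exp (-r) * r ^ x / x.factorial * Real.exp (s * x))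
      (Real.exp (r * (Real.exp s - 1))) := by
  have h := (NormedSpace.expSeries_div_hasSum_exp (𝔸 := ℝ) (r * Real.exp s)).mul_left
    (Real.exp (-r))
  rw [← Real.exp_eq_exp_ℝ, ← Real.exp_add] at h
  rw [show r * (Real.exp s - 1) = -r + r * Real.exp s by ring]
  refine Eq.mpr (congrArg (fun g : ℕ → ℝ => HasSum g _) (funext fun x => ?_)) h
  rw [mul_pow, ← Real.exp_nat_mul, mul_comm s]
  ring

lemma integrable_exp_mul_poisson (r : NNReal) (s : ℝ) :
    Integrable (fun x : ℕ => Real.exp (s * x)) (poissonMeasure r) := by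
  rw [integrable_poissonMeasure_iff]
  exact (hasSum_exp_mul_poisson r s).summable.congr fun x => by
    rw [Real.norm_of_nonneg (Real.exp_nonneg _)]

lemma mgf_poisson (r : NNReal) (s : ℝ) :
    mgf (fun x : ℕ => (x : ℝ)) (poissonMeasure r) s = Real.exp (r * (Real.exp s - 1)) := by
  rw [mgf, integral_poissonMeasure]
  exact (hasSum_exp_mul_poisson r s).tsum_eq

lemma one_sub_mul_exp_le {r : ℝ} (h0 : 0 ≤ r) : (1 - r) * Real.exp r ≤ 1 - r ^ 2 / 2 := by
  have hd : ∀ x : ℝ, HasDerivAt (fun x => 1 - x ^ 2 / 2 - (1 - x) * Real.exp x)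
      (x * (Real.exp x - 1)) x := by
    intro x
    have h1 := (((hasDerivAt_id x).pow 2).div_const 2).const_sub 1
    have h2 := ((hasDerivAt_id x).const_sub 1).mul (Real.hasDerivAt_exp x)
    exact (h1.sub h2).congr_deriv (by simp only [id]; ring)
  have hm : MonotoneOn (fun x => 1 - x ^ 2 / 2 - (1 - x) * Real.exp x) (Set.Ici 0) := by
    refine monotoneOn_of_deriv_nonneg (convex_Ici 0)
      (fun x _ => (hd x).continuousAt.continuousWithinAt)
      (fun x _ => (hd x).differentiableAt.differentiableWithinAt) fun x hx => ?_
    rw [interior_Ici] at hx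
    rw [(hd x).deriv]
    have := Real.add_one_le_exp x
    have hx0 : (0 : ℝ) < x := hx
    exact mul_nonneg hx0.le (by linarith)
  have := hm (Set.mem_Ici.2 le_rfl) (Set.mem_Ici.2 h0) h0
  simp at this
  linarith

lemma exp_neg_le_quadratic {r : ℝ} (h0 : 0 ≤ r) : Real.exp (-r) ≤ 1 - r + r ^ 2 / 2 := by
  have hd : ∀ x : ℝ, HasDerivAt (fun x => 1 - x + x ^ 2 / 2 - Real.exp (-x))
      (-1 + x + Real.exp (-x)) x := by
    intro x
    have h1 := ((hasDerivAt_id x).const_sub 1).add (((hasDerivAt_id x).pow 2).div_const 2)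
    have h2 := (hasDerivAt_id x).neg.exp
    exact (h1.sub h2).congr_deriv (by simp only [id, Pi.neg_apply]; ring)
  have hm : MonotoneOn (fun x => 1 - x + x ^ 2 / 2 - Real.exp (-x)) (Set.Ici 0) := by
    refine monotoneOn_of_deriv_nonneg (convex_Ici 0)
      (fun x _ => (hd x).continuousAt.continuousWithinAt)
      (fun x _ => (hd x).differentiableAt.differentiableWithinAt) fun x hx => ?_
    rw [(hd x).deriv]
    have := Real.add_one_le_exp (-x)
    linarith
  have := hm (Set.mem_Ici.2 le_rfl) (Set.mem_Ici.2 h0) h0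
  simp at this
  linarith

/-- The Chernoff bound for the upper tail of the Poisson distribution. -/
theorem poisson_upper_tail {r : NNReal} {a b : ℝ} (hra : r ≤ a) (hab : a ≤ b) (hb : 0 < b) :
    (poissonMeasure r).real {x : ℕ | b ≤ x} ≤ Real.exp (-((b - a) ^ 2 / (2 * b))) := by
  have ha : 0 ≤ a := r.2.trans hra
  -- Instead of the optimal `log (b / a)`, this choice gives the exponent `-b s² / 2` directly from
  -- `one_sub_mul_exp_le`.
  set s := (b - a) / b with hs
  have hs0 : 0 ≤ s := div_nonneg (by linarith) hb.le
  have has : a = b * (1 - s) := by rw [hs]; field_simp; ring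
  have h := measure_ge_le_exp_mul_mgf (X := fun x : ℕ => (x : ℝ)) b hs0
    (integrable_exp_mul_poisson r s)
  rw [mgf_poisson, ← Real.exp_add] at h
  refine h.trans (Real.exp_le_exp.2 ?_)
  have h1 : (r : ℝ) * (Real.exp s - 1) ≤ a * (Real.exp s - 1) :=
    mul_le_mul_of_nonneg_right hra (by linarith [Real.add_one_le_exp s])
  have h2 := mul_le_mul_of_nonneg_left (one_sub_mul_exp_le hs0) hb.le
  have h3 : (b - a) ^ 2 / (2 * b) = b * (s ^ 2 / 2) := by rw [hs]; field_simp
  rw [has] at h1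
  rw [h3]
  linarith

/-- The Chernoff bound for the lower tail of the Poisson distribution. -/
theorem poisson_lower_tail {r : NNReal} {a b : ℝ} (hbr : b ≤ r) (hab : a ≤ b) (hb : 0 < b) :
    (poissonMeasure r).real {x : ℕ | x ≤ a} ≤ Real.exp (-((b - a) ^ 2 / (2 * b))) := by
  set s := (b - a) / b with hs
  have hs0 : 0 ≤ s := div_nonneg (by linarith) hb.le
  have has : a = b * (1 - s) := by rw [hs]; field_simp; ring
  have h := measure_le_le_exp_mul_mgf (X := fun x : ℕ => (x : ℝ)) a (neg_nonpos.2 hs0)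
    (integrable_exp_mul_poisson r (-s))
  rw [mgf_poisson, ← Real.exp_add] at h
  refine h.trans (Real.exp_le_exp.2 ?_)
  have h1 : (r : ℝ) * (Real.exp (-s) - 1) ≤ b * (Real.exp (-s) - 1) :=
    mul_le_mul_of_nonpos_right hbr (by linarith [Real.exp_le_one_iff.2 (neg_nonpos.2 hs0)])
  have h2 := mul_le_mul_of_nonneg_left (exp_neg_le_quadratic hs0) hb.le
  have h3 : (b - a) ^ 2 / (2 * b) = b * (s ^ 2 / 2) := by rw [hs]; field_simp
  rw [h3]
  rw [neg_neg, has]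
  linarith

end L1Known

/-! ### Bias: approximation of `|x - q|` on the uncertainty set -/

namespace L1Known

open Polynomial Finset

lemma abs_sub_eval_le_supDist {f : ℝ → ℝ} {s : Set ℝ} (hf : ContinuousOn f s) (hs : IsCompact s)
    (P : ℝ[X]) {x : ℝ} (hx : x ∈ s) : |f x - P.eval x| ≤ supDist f s P := by
  have hc : ContinuousOn (fun z => |f z - P.eval z|) s := (hf.sub P.continuousOn).abs
  have hb : BddAbove (Set.range fun z : s => |f z - P.eval (z : ℝ)|) := by
    have := (hs.image_of_continuousOn hc).bddAbove
    rwa [Set.image_eq_range] at this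
  exact le_ciSup hb ⟨x, hx⟩

/-- By optimality, any explicit competitor of admissible degree bounds the error of the best
approximation. -/
lemma abs_sub_approxPoly_le {c₁ c₂ n q B : ℝ} (hB : 0 ≤ B) {R : ℝ[X]}
    (hR : R.natDegree ≤ deg c₂ n) (h : ∀ x ∈ U c₁ n q, |(|x - q|) - R.eval x| ≤ B)
    {x : ℝ} (hx : x ∈ U c₁ n q) : |(|x - q|) - (approxPoly c₁ c₂ n q).eval x| ≤ B :=
  (abs_sub_eval_le_supDist (f := fun x => |x - q|) (by fun_prop) (isCompact_U c₁ n q) _ hx).trans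
    (((isBestApprox_approxPoly c₁ c₂ n q).2 R hR).trans (Real.iSup_le (fun z => h z z.2) hB))

lemma sum_range_two_mul (f : ℕ → ℝ) (m : ℕ) :
    ∑ i ∈ range (2 * m), f i = ∑ k ∈ range m, (f (2 * k) + f (2 * k + 1)) := by
  induction m with
  | zero => simp
  | succ k ih => rw [sum_range_succ, ← ih, Nat.mul_succ, sum_range_succ, sum_range_succ]; ring

/-- The even part of a polynomial is a polynomial in the square. -/
lemma exists_eval_sq_eq_even_part {p : ℝ[X]} {K : ℕ} (hp : p.natDegree ≤ 2 * K) :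
    ∃ r : ℝ[X], r.natDegree ≤ K ∧ ∀ t, r.eval (t ^ 2) = (p.eval t + p.eval (-t)) / 2 := by
  refine ⟨∑ k ∈ range (K + 1), C (p.coeff (2 * k)) * X ^ k, ?_, fun t => ?_⟩
  · refine natDegree_sum_le_of_forall_le _ _ fun k hk => (natDegree_C_mul_X_pow_le _ _).trans ?_
    exact Nat.lt_succ_iff.1 (mem_range.1 hk)
  · have h : ∀ t, p.eval t = ∑ k ∈ range (K + 1),
        (p.coeff (2 * k) * t ^ (2 * k) + p.coeff (2 * k + 1) * t ^ (2 * k + 1)) := fun t => by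
      rw [eval_eq_sum_range' (by omega : p.natDegree < 2 * (K + 1)), sum_range_two_mul]
    rw [h, h, ← sum_add_distrib, sum_div, eval_finsetSum]
    refine sum_congr rfl fun k _ => ?_
    rw [eval_mul, eval_C, eval_pow, eval_X, ← pow_mul, pow_succ (-t), pow_mul (-t), neg_sq,
      ← pow_mul, pow_succ t]
    ring

/-- Approximation of `|x - q|` on `[0, L]`, with an error that improves as `q` approaches `0`. -/
lemma exists_polynomial_near_abs_sub {L q : ℝ} (hL : 0 < L) (hq : 0 ≤ q) {K : ℕ} (hK : 1 ≤ K) :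
    ∃ R : ℝ[X], R.natDegree ≤ K ∧
      ∀ x ∈ Set.Icc 0 L, |(|x - q|) - R.eval x| ≤ 16 * √(q * L) / K := by
  set a := √(q / L) with ha
  have ha0 : 0 ≤ a := Real.sqrt_nonneg _
  have ha2 : L * a ^ 2 = q := by rw [ha, Real.sq_sqrt (by positivity)]; field_simp
  have hLa : L * a = √(q * L) := by
    rw [← Real.sqrt_sq (by positivity : 0 ≤ L * a)]
    congr 1
    rw [mul_pow, ← ha2]; ring
  -- Under `x = L t²`, `q = L a²`, one has `|x - q| = x - q + 2 (q - x)₊` and `(q - x)₊ = L g(t)`.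
  -- The function `g` is even with Lipschitz constant only `2 a`, which is the source of the gain
  -- for small `q`.
  set g : ℝ → ℝ := fun t => a ^ 2 - (min a |t|) ^ 2 with hg
  have hlip : ∀ x ∈ Set.Icc (-1 : ℝ) 1, ∀ y ∈ Set.Icc (-1 : ℝ) 1,
      |g x - g y| ≤ 2 * a * |x - y| := by
    intro x _ y _
    have e : g x - g y = (min a |y| + min a |x|) * (min a |y| - min a |x|) := by
      simp only [hg]; ring
    rw [e, abs_mul]
    have h1 : |(min a |y| - min a |x|)| ≤ |x - y| := by
      have := abs_min_sub_min_le_max a |y| a |x|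
      rw [sub_self, abs_zero, max_eq_right (abs_nonneg _)] at this
      refine this.trans ?_
      rw [abs_sub_comm x y]
      exact abs_abs_sub_abs_le_abs_sub y x
    have h2 : |(min a |y| + min a |x|)| ≤ 2 * a := by
      rw [abs_of_nonneg (by positivity)]
      linarith [min_le_left a |y|, min_le_left a |x|]
    gcongr
  obtain ⟨p, hp, hpe⟩ := exists_polynomial_near_of_lipschitz (by positivity) hlip
    -- Degree `2 K` in `t` is affordable: the even part is a polynomial of degree at most `K` in
    -- `t²`, that is, in `x`.
    (m := 2 * K) (by omega)
  obtain ⟨r, hr, hre⟩ := exists_eval_sq_eq_even_part hp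
  refine ⟨X - C q + C (2 * L) * r.comp (C L⁻¹ * X), ?_, fun x hx => ?_⟩
  · refine (natDegree_add_le _ _).trans (max_le ?_ ((natDegree_C_mul_le _ _).trans ?_))
    · rw [natDegree_X_sub_C]; exact hK
    · refine natDegree_comp_le.trans ?_
      calc _ ≤ r.natDegree * 1 := Nat.mul_le_mul_left _ (by compute_degree)
        _ ≤ K := by simpa using hr
  · set t := √(x / L) with ht
    have ht0 : 0 ≤ t := Real.sqrt_nonneg _
    have ht2 : t ^ 2 = L⁻¹ * x := by
      rw [ht, Real.sq_sqrt (div_nonneg hx.1 hL.le)]; field_simp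
    have ht1 : t ≤ 1 := by
      rw [ht, Real.sqrt_le_one, div_le_one hL]; exact hx.2
    have hxt : x = L * t ^ 2 := by rw [ht2]; field_simp
    have habs : |x - q| = x - q + 2 * L * g t := by
      simp only [hg, abs_of_nonneg ht0]
      rw [hxt, ← ha2]
      rcases le_total a t with h | h
      · have := mul_le_mul_of_nonneg_left (pow_le_pow_left₀ ha0 h 2) hL.le
        rw [min_eq_left h, abs_of_nonneg (by linarith)]
        ring
      · have := mul_le_mul_of_nonneg_left (pow_le_pow_left₀ ht0 h 2) hL.le
        rw [min_eq_right h, abs_of_nonpos (by linarith)]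
        ring
    have h1 := hpe t ⟨by linarith, ht1⟩
    have h2 := hpe (-t) ⟨by linarith, by linarith⟩
    have hgn : g (-t) = g t := by simp [hg]
    rw [hgn] at h2
    have heval : (X - C q + C (2 * L) * r.comp (C L⁻¹ * X)).eval x
        = x - q + 2 * L * ((p.eval t + p.eval (-t)) / 2) := by
      rw [← hre, ht2]
      simp only [eval_add, eval_sub, eval_mul, eval_comp, eval_X, eval_C]
    rw [heval, habs]
    have e : x - q + 2 * L * g t - (x - q + 2 * L * ((p.eval t + p.eval (-t)) / 2))
        = L * ((g t - p.eval t) + (g t - p.eval (-t))) := by ring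
    rw [e, abs_mul, abs_of_pos hL, ← hLa]
    calc L * |g t - p.eval t + (g t - p.eval (-t))|
        ≤ L * (8 * (2 * a) / (2 * K : ℕ) + 8 * (2 * a) / (2 * K : ℕ)) := by
          gcongr; exact (abs_add_le _ _).trans (add_le_add h1 h2)
      _ = 16 * (L * a) / K := by push_cast; field_simp; ring

lemma exists_polynomial_near_abs_sub_symm {w q : ℝ} (hw : 0 < w) {K : ℕ} (hK : 2 ≤ K) :
    ∃ R : ℝ[X], R.natDegree ≤ K ∧
      ∀ x ∈ Set.Icc (q - w) (q + w), |(|x - q|) - R.eval x| ≤ 8 * w / K := by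
  obtain ⟨p, hp, hpe⟩ := exists_polynomial_near_of_lipschitz (f := fun x => |x|) zero_le_one
    (fun x _ y _ => by rw [one_mul]; exact abs_abs_sub_abs_le_abs_sub x y) hK
  refine ⟨C w * p.comp (C w⁻¹ * (X - C q)), ?_, fun x hx => ?_⟩
  · refine (natDegree_C_mul_le _ _).trans (natDegree_comp_le.trans ?_)
    calc _ ≤ p.natDegree * 1 := Nat.mul_le_mul_left _ (by compute_degree)
      _ ≤ K := by simpa using hp
  · have h := hpe (w⁻¹ * (x - q)) ⟨by
      rw [inv_mul_eq_div, le_div_iff₀ hw]; linarith [hx.1], by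
      rw [inv_mul_eq_div, div_le_iff₀ hw]; linarith [hx.2]⟩
    have heval : (C w * p.comp (C w⁻¹ * (X - C q))).eval x = w * p.eval (w⁻¹ * (x - q)) := by
      simp only [eval_sub, eval_mul, eval_comp, eval_X, eval_C]
    have e : |x - q| = w * |w⁻¹ * (x - q)| := by
      rw [abs_mul, abs_of_pos (inv_pos.2 hw)]; field_simp
    rw [heval, e, ← mul_sub, abs_mul, abs_of_pos hw]
    calc _ ≤ w * (8 * 1 / K) := by gcongr
      _ = 8 * w / K := by ring

/-- Exhibits the factor `log n` in the interval width that cancels against the degree `K`, which is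
of order `log n`. -/
lemma log_div_sqrt_bound {q n : ℝ} (hq : 0 ≤ q) (hn : 1 < n) (c : ℝ) (hc : 0 ≤ c) :
    √(c * q * Real.log n / n) = √c * Real.log n * √(q / (n * Real.log n)) := by
  have hl := Real.log_pos hn
  rw [Real.sqrt_eq_iff_eq_sq (by positivity) (by positivity), mul_pow, mul_pow, Real.sq_sqrt hc,
    Real.sq_sqrt (by positivity)]
  field_simp

/-- The bias of the polynomial part of the estimator. -/
theorem abs_sub_approxPoly_le_min {c₁ c₂ n q : ℝ} (hc₁ : 0 < c₁) (hc₂ : 0 < c₂) (hn : 1 < n)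
    (hn₂ : 2 ≤ c₂ * Real.log n) (hn₁ : 1 ≤ c₁ * Real.log n ^ 2) (hq : 0 ≤ q) {x : ℝ}
    (hx : x ∈ U c₁ n q) :
    |(|x - q|) - (approxPoly c₁ c₂ n q).eval x|
      ≤ (1 + 32 * √(2 * c₁) / c₂) * min q (√(q / (n * Real.log n))) := by
  have hl := Real.log_pos hn
  have hn0 : 0 < n := by linarith
  set K := deg c₂ n with hK
  have hK2 : 2 ≤ K := Nat.le_floor (by exact_mod_cast hn₂)
  have hKl : c₂ * Real.log n / 2 ≤ K := by
    have := Nat.lt_floor_add_one (c₂ * Real.log n)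
    have h2 : (⌊c₂ * Real.log n⌋₊ : ℝ) = K := rfl
    linarith
  have hK0 : (0 : ℝ) < K := by positivity
  set m := √(q / (n * Real.log n)) with hm
  have hm0 : 0 ≤ m := Real.sqrt_nonneg _
  have hC : 0 ≤ 32 * √(2 * c₁) / c₂ := by positivity
  by_cases hreg : q ≤ c₁ * Real.log n / n
  · have hU : U c₁ n q = Set.Icc 0 (2 * c₁ * Real.log n / n) := if_pos hreg
    rcases le_total q m with h | h
    · rw [min_eq_left h]
      -- The competitor `X` has error at most `q` on nonnegative reals, which is the smaller term of
      -- the minimum here.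
      have := abs_sub_approxPoly_le (c₁ := c₁) (c₂ := c₂) (q := q) (R := X) hq
        ((natDegree_X_le (R := ℝ)).trans (one_le_two.trans hK2)) (fun z hz => by
          rw [hU] at hz
          rw [eval_X, abs_le]
          rcases abs_cases (z - q) with h | h <;> constructor <;> linarith [hz.1]) hx
      nlinarith
    · rw [min_eq_right h]
      obtain ⟨R, hR, hRe⟩ := exists_polynomial_near_abs_sub
        (by positivity : 0 < 2 * c₁ * Real.log n / n) hq (by omega : 1 ≤ K)
      rw [← hU] at hRe
      have := abs_sub_approxPoly_le (by positivity) hR hRe hx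
      refine this.trans ?_
      rw [show q * (2 * c₁ * Real.log n / n) = 2 * c₁ * q * Real.log n / n by ring,
        log_div_sqrt_bound hq hn _ (by positivity)]
      calc 16 * (√(2 * c₁) * Real.log n * m) / K
          ≤ 16 * (√(2 * c₁) * Real.log n * m) / (c₂ * Real.log n / 2) := by gcongr
        _ = 32 * √(2 * c₁) / c₂ * m := by field_simp; ring
        _ ≤ _ := by nlinarith
  · have hU : U c₁ n q = Set.Icc (q - √(c₁ * q * Real.log n / n))
        (q + √(c₁ * q * Real.log n / n)) := if_neg hreg
    have hmq : m ≤ q := by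
      rw [hm, Real.sqrt_le_left hq, div_le_iff₀ (by positivity)]
      -- For large `q` the assumption `1 ≤ c₁ log² n` decides the minimum in favour of the square
      -- root.
      have h1 : 1 ≤ q * (n * Real.log n) := by
        rw [not_le, div_lt_iff₀ hn0] at hreg
        nlinarith
      nlinarith
    rw [min_eq_right hmq]
    have hq0 : 0 < q := lt_of_le_of_lt (by positivity) (not_le.1 hreg)
    obtain ⟨R, hR, hRe⟩ := exists_polynomial_near_abs_sub_symm (q := q)
      (Real.sqrt_pos.2 (by positivity : 0 < c₁ * q * Real.log n / n)) hK2
    rw [← hU] at hRe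
    have := abs_sub_approxPoly_le (by positivity) hR hRe hx
    refine this.trans ?_
    rw [log_div_sqrt_bound hq hn _ hc₁.le]
    have hs : √c₁ ≤ √(2 * c₁) := Real.sqrt_le_sqrt (by linarith)
    calc 8 * (√c₁ * Real.log n * m) / K
        ≤ 8 * (√(2 * c₁) * Real.log n * m) / (c₂ * Real.log n / 2) := by gcongr
      _ = 32 * √(2 * c₁) / c₂ * m / 2 := by field_simp; ring
      _ ≤ _ := by nlinarith [mul_nonneg hC hm0]

end L1Known

/-! ### Variance of the polynomial branch; classification events -/

namespace L1Known

open MeasureTheory ProbabilityTheory Polynomial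

/-- The variance of the polynomial part of the estimator. -/
theorem variance_approxPoly_le {c₁ c₂ n q p : ℝ} (hc₁ : 0 < c₁) (hc₂ : 0 < c₂)
    (hc : c₂ ≤ c₁ / 16) (hn : 1 < n) (hq : 0 ≤ q) (hp : 0 ≤ p) (hpU : p ∈ U c₁ n q) :
    variance (fun y : ℕ => unbiased n (approxPoly c₁ c₂ n q) (y / n))
        (poissonMeasure (n * p).toNNReal)
      ≤ (64 * c₂ + 4 * c₁) * (p + q) * (Real.log n / n) * 32 ^ deg c₂ n := by
  have hl := Real.log_pos hn
  have hn0 : 0 < n := by linarith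
  set ℓ := Real.log n with hℓ
  set K := deg c₂ n with hK
  have hKl : (K : ℝ) ≤ c₂ * ℓ := Nat.floor_le (by positivity)
  have hdeg : (approxPoly c₁ c₂ n q).natDegree ≤ K := (isBestApprox_approxPoly c₁ c₂ n q).1
  -- Comparison with the zero polynomial: the best approximation is within `B` of `|x - q|`, hence
  -- at most `2 B` in size.
  have hbound : ∀ B, 0 ≤ B → (∀ x ∈ U c₁ n q, |x - q| ≤ B) →
      ∀ x ∈ U c₁ n q, |(approxPoly c₁ c₂ n q).eval x| ≤ 2 * B := by
    intro B hB h x hx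
    have h1 := abs_sub_approxPoly_le (c₂ := c₂) (R := 0) hB (by simp)
      (fun z hz => by simpa using h z hz) hx
    have h2 := h x hx
    rw [abs_le] at h1 ⊢
    constructor <;> linarith [abs_nonneg (x - q)]
  by_cases hreg : q ≤ c₁ * Real.log n / n
  · have hU : U c₁ n q = Set.Icc 0 (2 * c₁ * Real.log n / n) := if_pos hreg
    set L := 2 * c₁ * Real.log n / n with hL
    have hL0 : 0 < L := by positivity
    have hqL : q ≤ L := hreg.trans (by rw [hL]; gcongr; linarith)
    rw [hU] at hpU hbound
    have hM := hbound L hL0.le (fun x hx => by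
      rw [abs_le]; constructor <;> linarith [hx.1, hx.2])
    -- A segment of half the length of `U`, starting at `p` and pointing towards the centre, stays
    -- inside `U`.
    obtain ⟨w, hw2, hw⟩ : ∃ w : ℝ, w ^ 2 = L ^ 2 / 4 ∧
        ∀ s ∈ Set.Icc (0 : ℝ) 1, p + w * s ∈ Set.Icc 0 L := by
      rcases le_total p (L / 2) with h | h
      · refine ⟨L / 2, by ring, fun s hs => ⟨?_, ?_⟩⟩
        · have := mul_nonneg hL0.le hs.1; linarith
        · have := mul_le_mul_of_nonneg_left hs.2 hL0.le; linarith
      · refine ⟨-(L / 2), by ring, fun s hs => ⟨?_, ?_⟩⟩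
        · have := mul_le_mul_of_nonneg_left hs.2 hL0.le; linarith
        · have := mul_nonneg hL0.le hs.1; linarith [hpU.2]
    -- This is where `c₂ ≤ c₁ / 16` is needed.
    have hρ : 4 * K * p / (n * w ^ 2) ≤ 1 := by
      rw [hw2, div_le_one (by positivity)]
      calc 4 * K * p ≤ 4 * (c₁ / 16 * ℓ) * L := by
            gcongr
            · exact hKl.trans (by gcongr)
            · exact hpU.2
        _ = n * (L * L / 8) := by rw [hL]; field_simp; ring
        _ ≤ n * (L ^ 2 / 4) := by gcongr ?_ * ?_; nlinarith
    have hw0 : w ≠ 0 := by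
      rintro rfl
      nlinarith
    refine (variance_unbiased_le hn0 hp hdeg (by positivity : 0 < 2 * L) hw0
      (fun s hs => hM _ (hw s hs)) hρ).trans ?_
    refine mul_le_mul_of_nonneg_right ?_ (by positivity)
    rw [hw2]
    calc 4 * K * p / (n * (L ^ 2 / 4)) * (2 * L) ^ 2 = 64 * K * (p / n) := by
          field_simp; ring
      _ ≤ 64 * (c₂ * ℓ) * (p / n) := by gcongr
      _ = 64 * c₂ * p * (ℓ / n) := by ring
      _ ≤ (64 * c₂ + 4 * c₁) * (p + q) * (ℓ / n) := by
          gcongr <;> linarith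
  · have hU : U c₁ n q = Set.Icc (q - √(c₁ * q * Real.log n / n))
        (q + √(c₁ * q * Real.log n / n)) := if_neg hreg
    have hq0 : 0 < q := lt_of_le_of_lt (by positivity) (not_le.1 hreg)
    set w₀ := √(c₁ * q * Real.log n / n) with hw₀
    have hw₀0 : 0 < w₀ := Real.sqrt_pos.2 (by positivity)
    have hw₀2 : w₀ ^ 2 = c₁ * q * ℓ / n := Real.sq_sqrt (by positivity)
    have hw₀q : w₀ ≤ q := by
      rw [hw₀, Real.sqrt_le_left hq]
      rw [not_le] at hreg
      calc c₁ * q * Real.log n / n = (c₁ * Real.log n / n) * q := by ring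
        _ ≤ q * q := by gcongr
        _ = q ^ 2 := by ring
    rw [hU] at hpU hbound
    have hM := hbound w₀ hw₀0.le (fun x hx => by
      rw [abs_le]; constructor <;> linarith [hx.1, hx.2])
    obtain ⟨w, hw2, hw⟩ : ∃ w : ℝ, w ^ 2 = w₀ ^ 2 ∧
        ∀ s ∈ Set.Icc (0 : ℝ) 1, p + w * s ∈ Set.Icc (q - w₀) (q + w₀) := by
      rcases le_total p q with h | h
      · refine ⟨w₀, by ring, fun s hs => ⟨?_, ?_⟩⟩
        · have := mul_nonneg hw₀0.le hs.1; linarith [hpU.1]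
        · have := mul_le_mul_of_nonneg_left hs.2 hw₀0.le; linarith
      · refine ⟨-w₀, by ring, fun s hs => ⟨?_, ?_⟩⟩
        · have := mul_le_mul_of_nonneg_left hs.2 hw₀0.le; linarith
        · have := mul_nonneg hw₀0.le hs.1; linarith [hpU.2]
    have hρ : 4 * K * p / (n * w ^ 2) ≤ 1 := by
      rw [hw2, div_le_one (by positivity), hw₀2]
      calc 4 * K * p ≤ 4 * (c₁ / 16 * ℓ) * (2 * q) := by
            gcongr
            · exact hKl.trans (by gcongr)
            · linarith [hpU.2]
        _ = n * (c₁ * q * ℓ / n) / 2 := by field_simp; ring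
        _ ≤ n * (c₁ * q * ℓ / n) := half_le_self (by positivity)
    have hw0 : w ≠ 0 := by
      rintro rfl
      nlinarith
    refine (variance_unbiased_le hn0 hp hdeg (by positivity : 0 < 2 * w₀) hw0
      (fun s hs => hM _ (hw s hs)) hρ).trans ?_
    refine mul_le_mul_of_nonneg_right ?_ (by positivity)
    -- The factor `ρ` can be dropped here, since `w₀²` is already proportional to `q`.
    calc 4 * K * p / (n * w ^ 2) * (2 * w₀) ^ 2 ≤ 1 * (2 * w₀) ^ 2 := by gcongr
      _ = 4 * c₁ * q * (ℓ / n) := by rw [mul_pow, hw₀2]; ring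
      _ ≤ (64 * c₂ + 4 * c₁) * (p + q) * (ℓ / n) := by
          gcongr <;> linarith

/-- The count `x` from the first half of the sample does not misclassify the symbol. -/
def WellClassified (c₁ c₃ n q p : ℝ) (x : ℕ) : Prop :=
  ((∀ u ∈ U₁ c₁ c₃ n q, u < x / n) → q ≤ p) ∧ ((∀ u ∈ U₁ c₁ c₃ n q, (x / n : ℝ) < u) → p ≤ q) ∧
    ((x / n : ℝ) ∈ U₁ c₁ c₃ n q → p ∈ U c₁ n q)

lemma U₁_eq_Icc (c₁ c₃ n q : ℝ) (hc₁ : 0 ≤ c₁) (hc₃ : 0 ≤ c₃) (hn : 1 < n) :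
    ∃ a b, a ≤ b ∧ U₁ c₁ c₃ n q = Set.Icc a b := by
  have := Real.log_pos hn
  unfold U₁
  split_ifs
  · exact ⟨_, _, by positivity, rfl⟩
  · exact ⟨_, _, by linarith [Real.sqrt_nonneg (c₃ * q * Real.log n / n)], rfl⟩

lemma rpow_tail_bound {n c t : ℝ} (hn : 1 < n) (h : c / 40 * Real.log n ≤ t) :
    Real.exp (-t) ≤ n ^ (-(c / 40)) := by
  rw [Real.rpow_def_of_pos (by linarith)]
  exact Real.exp_le_exp.2 (by linarith)

lemma poisson_real_le_of_upper {n p c a b : ℝ} (hn : 1 < n) (hp : 0 ≤ p) (hpa : n * p ≤ a)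
    (hab : a ≤ b) (hb : 0 < b) (h : c / 40 * Real.log n * (2 * b) ≤ (b - a) ^ 2) {s : Set ℕ}
    (hs : ∀ x ∈ s, b ≤ (x : ℝ)) :
    (poissonMeasure (n * p).toNNReal).real s ≤ n ^ (-(c / 40)) := by
  refine (measureReal_mono (fun x hx => hs x hx)).trans ((poisson_upper_tail (a := a) ?_ hab
    hb).trans (rpow_tail_bound hn ?_))
  · rwa [Real.coe_toNNReal _ (by positivity)]
  · rwa [le_div_iff₀ (by positivity)]

lemma poisson_real_le_of_lower {n p c a b : ℝ} (hn : 1 < n) (hp : 0 ≤ p) (hpb : b ≤ n * p)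
    (hab : a ≤ b) (hb : 0 < b) (h : c / 40 * Real.log n * (2 * b) ≤ (b - a) ^ 2) {s : Set ℕ}
    (hs : ∀ x ∈ s, (x : ℝ) ≤ a) :
    (poissonMeasure (n * p).toNNReal).real s ≤ n ^ (-(c / 40)) := by
  refine (measureReal_mono (fun x hx => hs x hx)).trans ((poisson_lower_tail (b := b) ?_ hab
    hb).trans (rpow_tail_bound hn ?_))
  · rwa [Real.coe_toNNReal _ (by positivity)]
  · rwa [le_div_iff₀ (by positivity)]

end L1Known

/-! ### Probability of misclassification -/

namespace L1Known

open MeasureTheory ProbabilityTheory Polynomial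

variable {c n q p : ℝ}

/-- On the scale of counts, `W` is the half-width of `U` and `W / 2` that of `U₁` with `c₃ = c / 4`.
Every misclassification in this regime therefore needs a deviation of at least `W / 2`, while the
mean level `n q` dominates `W`. -/
lemma deviation_facts (hc : 0 < c) (hn : 1 < n) (hreg : ¬ q ≤ c * Real.log n / n) :
    ∃ W : ℝ, 0 < W ∧ W ≤ n * q ∧ W ^ 2 = c * Real.log n * (n * q) ∧
      √(c * q * Real.log n / n) = W / n ∧ √(c / 4 * q * Real.log n / n) = W / 2 / n := by
  have hl := Real.log_pos hn
  have hn0 : 0 < n := by linarith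
  have hq0 : 0 < q := lt_of_le_of_lt (by positivity) (not_le.1 hreg)
  have hW2 : √(c * Real.log n * (n * q)) ^ 2 = c * Real.log n * (n * q) :=
    Real.sq_sqrt (by positivity)
  refine ⟨√(c * Real.log n * (n * q)), Real.sqrt_pos.2 (by positivity), ?_, hW2, ?_, ?_⟩
  · rw [Real.sqrt_le_left (by positivity), sq]
    rw [not_le, div_lt_iff₀ hn0] at hreg
    exact mul_le_mul_of_nonneg_right (by linarith) (by positivity)
  · rw [Real.sqrt_eq_iff_eq_sq (by positivity) (by positivity), div_pow, hW2]
    field_simp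
  · rw [Real.sqrt_eq_iff_eq_sq (by positivity) (by positivity), div_pow, div_pow, hW2]
    field_simp
    norm_num

lemma poisson_above_le (hc : 0 < c) (hn : 1 < n) (hp : 0 ≤ p) (hpq : p < q) :
    (poissonMeasure (n * p).toNNReal).real {x : ℕ | ∀ u ∈ U₁ c (c / 4) n q, u < x / n}
      ≤ n ^ (-(c / 40)) := by
  have hl := Real.log_pos hn
  have hn0 : 0 < n := by linarith
  by_cases hreg : q ≤ c * Real.log n / n
  · have hU : U₁ c (c / 4) n q = Set.Icc 0 ((c + c / 4) * Real.log n / n) := if_pos hreg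
    -- The critical case for the constant 40: `(1/4)² / (2 · 5/4) = 1/40` exactly.
    refine poisson_real_le_of_upper (a := c * Real.log n) (b := (c + c / 4) * Real.log n) hn hp
      ?_ (by gcongr; linarith) (by positivity) (le_of_eq (by ring)) fun x hx => ?_
    · rw [le_div_iff₀ hn0] at hreg; nlinarith
    · have h := hx ((c + c / 4) * Real.log n / n) (by
        rw [hU]; exact Set.right_mem_Icc.2 (by positivity))
      exact ((div_lt_div_iff_of_pos_right hn0).1 h).le
  · obtain ⟨W, hW, hWμ, hW2, -, hW4⟩ := deviation_facts hc hn hreg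
    have hU : U₁ c (c / 4) n q = Set.Icc (q - W / 2 / n) (q + W / 2 / n) := by
      rw [← hW4]; exact if_neg hreg
    refine poisson_real_le_of_upper (a := n * q) (b := n * q + W / 2) hn hp (by gcongr)
      (by linarith) (by linarith) ?_ fun x hx => ?_
    · have := mul_le_mul_of_nonneg_left hWμ (by positivity : 0 ≤ c * Real.log n)
      have h0 : 0 < c * Real.log n * (n * q) := hW2 ▸ pow_pos hW 2
      nlinarith
    · have h := hx (q + W / 2 / n) (by
        rw [hU]; exact Set.right_mem_Icc.2 (by linarith [div_pos (half_pos hW) hn0]))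
      rw [lt_div_iff₀ hn0] at h
      field_simp at h ⊢
      linarith

lemma poisson_below_le (hc : 0 < c) (hn : 1 < n) (hp : 0 ≤ p) (hpq : q < p) :
    (poissonMeasure (n * p).toNNReal).real {x : ℕ | ∀ u ∈ U₁ c (c / 4) n q, (x / n : ℝ) < u}
      ≤ n ^ (-(c / 40)) := by
  have hl := Real.log_pos hn
  have hn0 : 0 < n := by linarith
  by_cases hreg : q ≤ c * Real.log n / n
  · have hU : U₁ c (c / 4) n q = Set.Icc 0 ((c + c / 4) * Real.log n / n) := if_pos hreg
    -- Here `U₁` contains `0`, so no count can fall below it.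
    have : {x : ℕ | ∀ u ∈ U₁ c (c / 4) n q, (x / n : ℝ) < u} = ∅ := by
      refine Set.eq_empty_of_forall_notMem fun x hx => ?_
      have h := hx 0 (by rw [hU]; exact Set.left_mem_Icc.2 (by positivity))
      exact absurd h (not_lt.2 (by positivity))
    rw [this, measureReal_empty]
    positivity
  · obtain ⟨W, hW, hWμ, hW2, -, hW4⟩ := deviation_facts hc hn hreg
    have hU : U₁ c (c / 4) n q = Set.Icc (q - W / 2 / n) (q + W / 2 / n) := by
      rw [← hW4]; exact if_neg hreg
    refine poisson_real_le_of_lower (a := n * q - W / 2) (b := n * q) hn hp (by gcongr)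
      (by linarith) (by linarith) ?_ fun x hx => ?_
    · have h0 : 0 < c * Real.log n * (n * q) := hW2 ▸ pow_pos hW 2
      nlinarith
    · have h := hx (q - W / 2 / n) (by
        rw [hU]; exact Set.left_mem_Icc.2 (by linarith [div_pos (half_pos hW) hn0]))
      rw [div_lt_iff₀ hn0] at h
      field_simp at h ⊢
      linarith

lemma poisson_mem_U₁_le (hc : 0 < c) (hn : 1 < n) (hp : 0 ≤ p) (hpU : p ∉ U c n q) :
    (poissonMeasure (n * p).toNNReal).real {x : ℕ | (x / n : ℝ) ∈ U₁ c (c / 4) n q}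
      ≤ n ^ (-(c / 40)) := by
  have hl := Real.log_pos hn
  have hn0 : 0 < n := by linarith
  by_cases hreg : q ≤ c * Real.log n / n
  · have hU₁ : U₁ c (c / 4) n q = Set.Icc 0 ((c + c / 4) * Real.log n / n) := if_pos hreg
    have hU : U c n q = Set.Icc 0 (2 * c * Real.log n / n) := if_pos hreg
    rw [hU, Set.mem_Icc, not_and, not_le] at hpU
    have hp2 := hpU hp
    rw [div_lt_iff₀ hn0] at hp2
    have hcl : 0 < c * Real.log n := by positivity
    refine poisson_real_le_of_lower (a := (c + c / 4) * Real.log n) (b := 2 * c * Real.log n) hn hp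
      (by linarith) (by linarith) (by positivity) (by nlinarith) fun x hx => ?_
    have h : (x / n : ℝ) ∈ U₁ c (c / 4) n q := hx
    rw [hU₁] at h
    exact (div_le_div_iff_of_pos_right hn0).1 h.2
  · obtain ⟨W, hW, hWμ, hW2, hW1, hW4⟩ := deviation_facts hc hn hreg
    have hU₁ : U₁ c (c / 4) n q = Set.Icc (q - W / 2 / n) (q + W / 2 / n) := by
      rw [← hW4]; exact if_neg hreg
    have hU : U c n q = Set.Icc (q - W / n) (q + W / n) := by
      rw [← hW1]; exact if_neg hreg
    have h0 : 0 < c * Real.log n * (n * q) := hW2 ▸ pow_pos hW 2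
    have h1 := mul_le_mul_of_nonneg_left hWμ (by positivity : 0 ≤ c * Real.log n)
    have h2 : 0 < c * Real.log n * W := by positivity
    rw [hU, Set.mem_Icc, not_and_or, not_le, not_le] at hpU
    rcases hpU with hpU | hpU
    · refine poisson_real_le_of_upper (a := n * q - W) (b := n * q - W / 2) hn hp ?_
        (by linarith) (by linarith) (by nlinarith) fun x hx => ?_
      · field_simp at hpU; linarith
      · have h : (x / n : ℝ) ∈ U₁ c (c / 4) n q := hx
        rw [hU₁] at h
        have h3 := h.1
        rw [le_div_iff₀ hn0] at h3
        field_simp at h3 ⊢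
        linarith
    · refine poisson_real_le_of_lower (a := n * q + W / 2) (b := n * q + W) hn hp ?_
        (by linarith) (by linarith) (by nlinarith) fun x hx => ?_
      · field_simp at hpU; linarith
      · have h : (x / n : ℝ) ∈ U₁ c (c / 4) n q := hx
        rw [hU₁] at h
        have h3 := h.2
        rw [div_le_iff₀ hn0] at h3
        field_simp at h3 ⊢
        linarith

/-- Misclassification of a symbol is unlikely. -/
theorem poisson_not_wellClassified_le (hc : 0 < c) (hn : 1 < n) (hp : 0 ≤ p) :
    (poissonMeasure (n * p).toNNReal).real {x : ℕ | ¬ WellClassified c (c / 4) n q p x}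
      ≤ 3 * n ^ (-(c / 40)) := by
  set μ := poissonMeasure (n * p).toNNReal
  have hδ : 0 ≤ n ^ (-(c / 40)) := by positivity
  have key : ∀ (A : ℕ → Prop) (B : Prop), (¬ B → μ.real {x | A x} ≤ n ^ (-(c / 40))) →
      μ.real {x | ¬ (A x → B)} ≤ n ^ (-(c / 40)) := by
    intro A B h
    by_cases hB : B
    · simpa [hB] using hδ
    · refine (measureReal_mono fun x hx => ?_).trans (h hB)
      exact (Classical.not_imp.1 hx).1
  have hsub : {x : ℕ | ¬ WellClassified c (c / 4) n q p x}
      ⊆ {x : ℕ | ¬ ((∀ u ∈ U₁ c (c / 4) n q, u < x / n) → q ≤ p)} ∪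
        ({x : ℕ | ¬ ((∀ u ∈ U₁ c (c / 4) n q, (x / n : ℝ) < u) → p ≤ q)} ∪
        {x : ℕ | ¬ ((x / n : ℝ) ∈ U₁ c (c / 4) n q → p ∈ U c n q)}) := by
    intro x hx
    simp only [WellClassified, Set.mem_ofPred_eq, Set.mem_union] at hx ⊢
    tauto
  have h1 := key _ (q ≤ p) fun h => poisson_above_le hc hn hp (not_le.1 h)
  have h2 := key _ (p ≤ q) fun h => poisson_below_le hc hn hp (not_le.1 h)
  have h3 := key _ (p ∈ U c n q) fun h => poisson_mem_U₁_le hc hn hp h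
  refine (measureReal_mono hsub).trans ((measureReal_union_le _ _).trans ?_)
  have h4 := measureReal_union_le (μ := μ)
    {x : ℕ | ¬ ((∀ u ∈ U₁ c (c / 4) n q, (x / n : ℝ) < u) → p ≤ q)}
    {x : ℕ | ¬ ((x / n : ℝ) ∈ U₁ c (c / 4) n q → p ∈ U c n q)}
  linarith

end L1Known

/-! ### From one symbol to the risk -/

namespace L1Known

open MeasureTheory ProbabilityTheory Polynomial

open Classical in
/-- The contribution of one symbol to `preEstimator`. -/
noncomputable def summand (c₁ c₂ c₃ n q : ℝ) (x y : ℕ) : ℝ :=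
  (if ∀ u ∈ U₁ c₁ c₃ n q, u < x / n then y / n - q else 0)
    + (if ∀ u ∈ U₁ c₁ c₃ n q, (x / n : ℝ) < u then q - y / n else 0)
    + (if (x / n : ℝ) ∈ U₁ c₁ c₃ n q then unbiased n (approxPoly c₁ c₂ n q) (y / n) else 0)

variable {c₁ c₂ c₃ n q p : ℝ}

lemma unbiased_linear (n a b : ℝ) (y : ℕ) :
    unbiased n (C a * X + C b) (y / n) = a * (y / n) + b := by
  rw [unbiased_eq_sum_descFactorial n (K := 1) (by compute_degree)]
  simp [Finset.sum_range_succ, coeff_X, coeff_C]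
  ring

lemma variance_unbiased_linear (hn : 0 < n) (hp : 0 ≤ p) (a b : ℝ) :
    variance (fun y : ℕ => unbiased n (C a * X + C b) (y / n)) (poissonMeasure (n * p).toNNReal)
      = p / n * a ^ 2 := by
  rw [variance_unbiased hn hp (K := 1) (by compute_degree)]
  simp

/-- On a well-classified symbol the estimator is the unbiased estimate of a polynomial that is
close to `|p - q|`. -/
lemma exists_summand_eq_unbiased (hc₁ : 0 < c₁) (hc₃ : 0 ≤ c₃) (hn : 1 < n) {x : ℕ}
    (hx : WellClassified c₁ c₃ n q p x) :
    ∃ R : ℝ[X], (∀ y : ℕ, summand c₁ c₂ c₃ n q x y = unbiased n R (y / n)) ∧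
      (R = approxPoly c₁ c₂ n q ∧ p ∈ U c₁ n q ∨
        R.eval p = |p - q| ∧ ∃ a b, a ^ 2 = 1 ∧ R = C a * X + C b) := by
  obtain ⟨l, r, hlr, hU⟩ := U₁_eq_Icc c₁ c₃ n q hc₁.le hc₃ hn
  obtain ⟨h1, h2, h3⟩ := hx
  -- Nonemptiness of the interval `U₁` matters: over an empty set the conditions "above" and "below"
  -- would both hold vacuously, while here the three branches are exclusive.
  have ha : (∀ u ∈ U₁ c₁ c₃ n q, u < (x / n : ℝ)) ↔ r < x / n := by
    rw [hU]; exact ⟨fun h => h r (Set.right_mem_Icc.2 hlr), fun h u hu => hu.2.trans_lt h⟩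
  have hb : (∀ u ∈ U₁ c₁ c₃ n q, (x / n : ℝ) < u) ↔ x / n < l := by
    rw [hU]; exact ⟨fun h => h l (Set.left_mem_Icc.2 hlr), fun h u hu => h.trans_le hu.1⟩
  have hm : (x / n : ℝ) ∈ U₁ c₁ c₃ n q ↔ l ≤ x / n ∧ x / n ≤ r := by rw [hU]; exact Iff.rfl
  simp only [summand]
  rcases lt_or_ge r (x / n) with hr | hr
  · refine ⟨C 1 * X + C (-q), fun y => ?_, Or.inr ⟨?_, 1, -q, by norm_num, rfl⟩⟩
    · rw [if_pos (ha.2 hr), if_neg (fun h => (hb.1 h).not_ge (hlr.trans hr.le)),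
        if_neg (fun h => hr.not_ge (hm.1 h).2), unbiased_linear]
      ring
    · rw [abs_of_nonneg (by linarith [h1 (ha.2 hr)])]
      simp; ring
  rcases lt_or_ge (x / n) l with hl | hl
  · refine ⟨C (-1) * X + C q, fun y => ?_, Or.inr ⟨?_, -1, q, by norm_num, rfl⟩⟩
    · rw [if_neg (fun h => (ha.1 h).not_ge hr), if_pos (hb.2 hl),
        if_neg (fun h => hl.not_ge (hm.1 h).1), unbiased_linear]
      ring
    · rw [abs_of_nonpos (by linarith [h2 (hb.2 hl)])]
      simp; ring
  · refine ⟨approxPoly c₁ c₂ n q, fun y => ?_, Or.inl ⟨rfl, h3 (hm.2 ⟨hl, hr⟩)⟩⟩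
    rw [if_neg (fun h => (ha.1 h).not_ge hr), if_neg (fun h => (hb.1 h).not_ge hl),
      if_pos (hm.2 ⟨hl, hr⟩)]
    ring

/-- Bias and variance of the contribution of a well-classified symbol. -/
theorem summand_bias_variance {ε : ℝ} (hc₁ : 0 < c₁) (hc₂ : 0 < c₂) (hc : c₂ ≤ c₁ / 16)
    (hc₃ : 0 ≤ c₃) (hn : 1 < n) (hn₂ : 2 ≤ c₂ * Real.log n) (hn₁ : 1 ≤ c₁ * Real.log n ^ 2)
    (hlog : 1 ≤ Real.log n) (hε : 0 ≤ ε) (hdeg : (32 : ℝ) ^ deg c₂ n ≤ n ^ ε)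
    (hq : 0 ≤ q) (hp : 0 ≤ p) {x : ℕ} (hx : WellClassified c₁ c₃ n q p x) :
    MemLp (fun y : ℕ => summand c₁ c₂ c₃ n q x y) 2 (poissonMeasure (n * p).toNNReal) ∧
    |∫ y : ℕ, summand c₁ c₂ c₃ n q x y ∂(poissonMeasure (n * p).toNNReal) - (|p - q|)|
      ≤ (1 + 32 * √(2 * c₁) / c₂) * min q (√(q / (n * Real.log n))) ∧
    variance (fun y : ℕ => summand c₁ c₂ c₃ n q x y) (poissonMeasure (n * p).toNNReal)
      ≤ (64 * c₂ + 4 * c₁ + 1) * (p + q) * (Real.log n / n * n ^ ε) := by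
  have hn0 : 0 < n := by linarith
  have hnε : 1 ≤ n ^ ε := Real.one_le_rpow hn.le hε
  obtain ⟨R, hR, hcase⟩ := exists_summand_eq_unbiased (c₂ := c₂) hc₁ hc₃ hn hx
  simp_rw [hR]
  rw [(unbiased_spec hn0 hp R).2]
  refine ⟨memLp_unbiased hn0 hp R, ?_, ?_⟩
  · rcases hcase with ⟨rfl, hpU⟩ | ⟨hRp, -⟩
    · rw [abs_sub_comm]
      exact abs_sub_approxPoly_le_min hc₁ hc₂ hn hn₂ hn₁ hq hpU
    · rw [hRp, sub_self, abs_zero]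
      positivity
  · rcases hcase with ⟨rfl, hpU⟩ | ⟨-, a, b, ha, rfl⟩
    · refine (variance_approxPoly_le hc₁ hc₂ hc hn hq hp hpU).trans ?_
      rw [mul_assoc _ (Real.log n / n)]
      exact mul_le_mul (mul_le_mul_of_nonneg_right (by linarith) (by positivity))
        (by gcongr) (by positivity) (by positivity)
    · rw [variance_unbiased_linear hn0 hp, ha, mul_one]
      calc p / n = 1 * p * (1 / n * 1) := by ring
        _ ≤ (64 * c₂ + 4 * c₁ + 1) * (p + q) * (Real.log n / n * n ^ ε) := by
          gcongr <;> linarith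

/-- Bias-variance decomposition for a sum of functions of independent variables. -/
lemma integral_sum_sub_sq {S : ℕ} {μ : Fin S → Measure ℕ} [∀ i, IsProbabilityMeasure (μ i)]
    {h : Fin S → ℕ → ℝ} (hh : ∀ i, MemLp (h i) 2 (μ i)) (θ : ℝ) :
    Integrable (fun y : Fin S → ℕ => (∑ i, h i (y i) - θ) ^ 2) (Measure.pi μ) ∧
    ∫ y : Fin S → ℕ, (∑ i, h i (y i) - θ) ^ 2 ∂(Measure.pi μ)
      = ∑ i, variance (h i) (μ i) + (∑ i, ∫ y, h i y ∂(μ i) - θ) ^ 2 := by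
  have hmem : ∀ i, MemLp (fun y : Fin S → ℕ => h i (y i)) 2 (Measure.pi μ) := fun i =>
    (hh i).comp_measurePreserving (measurePreserving_eval _ i)
  have hsum : MemLp (fun y : Fin S → ℕ => ∑ i, h i (y i)) 2 (Measure.pi μ) :=
    memLp_finsetSum _ fun i _ => hmem i
  have hZ : MemLp (fun y : Fin S → ℕ => ∑ i, h i (y i) - θ) 2 (Measure.pi μ) :=
    hsum.sub (memLp_const θ)
  refine ⟨hZ.integrable_sq, ?_⟩
  have hv := variance_eq_sub hZ
  rw [variance_sub_const hsum.aestronglyMeasurable] at hv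
  have hvs := variance_sum_pi hh
  have e : (∑ i, fun y : Fin S → ℕ => h i (y i)) = fun y => ∑ i, h i (y i) := by
    funext y; simp
  rw [e] at hvs
  rw [hvs] at hv
  have hmean : ∫ y : Fin S → ℕ, (∑ i, h i (y i) - θ) ∂(Measure.pi μ)
      = ∑ i, ∫ y, h i y ∂(μ i) - θ := by
    rw [integral_sub (hsum.integrable one_le_two) (integrable_const θ),
      integral_finsetSum _ fun i _ => (hmem i).integrable one_le_two]
    simp only [integral_const, probReal_univ, one_smul]
    congr 1
    refine Finset.sum_congr rfl fun i _ => ?_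
    have := (measurePreserving_eval μ i).map_eq
    rw [← this, integral_map (measurable_pi_apply i).aemeasurable
      Measurable.of_discrete.aestronglyMeasurable]
  rw [hmean] at hv
  have e2 : ∫ y : Fin S → ℕ, (∑ i, h i (y i) - θ) ^ 2 ∂(Measure.pi μ)
    = ∫ y, ((fun y : Fin S → ℕ => ∑ i, h i (y i) - θ) ^ 2) y ∂(Measure.pi μ) := rfl
  rw [e2]
  linarith

lemma L1_mem_Icc {S : ℕ} {P Q : Fin S → ℝ} (hP : P ∈ stdSimplex ℝ (Fin S))
    (hQ : Q ∈ stdSimplex ℝ (Fin S)) : L1 P Q ∈ Set.Icc 0 2 := by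
  refine ⟨Finset.sum_nonneg fun i _ => abs_nonneg _, ?_⟩
  calc L1 P Q ≤ ∑ i, (P i + Q i) := Finset.sum_le_sum fun i _ => by
        rw [abs_le]; constructor <;> linarith [hP.1 i, hQ.1 i]
    _ = 2 := by rw [Finset.sum_add_distrib, hP.2, hQ.2]; norm_num

/-- Clipping projects onto `[0, 2]`, which contains the target: the error never grows and never
exceeds the length of the interval. -/
lemma abs_clip_sub_le {θ : ℝ} (hθ : θ ∈ Set.Icc (0 : ℝ) 2) (t : ℝ) :
    |max 0 (min t 2) - θ| ≤ |t - θ| ∧ |max 0 (min t 2) - θ| ≤ 2 := by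
  obtain ⟨h0, h2⟩ := hθ
  constructor
  · rcases le_total t 2 with h | h
    · rw [min_eq_left h]
      rcases le_total 0 t with h' | h'
      · rw [max_eq_right h']
      · rw [max_eq_left h', abs_of_nonpos (by linarith), abs_of_nonpos (by linarith)]; linarith
    · rw [min_eq_right h, max_eq_right zero_le_two, abs_of_nonneg (by linarith),
        abs_of_nonneg (by linarith)]; linarith
  · have : max 0 (min t 2) ≤ 2 := max_le zero_le_two (min_le_right _ _)
    have : 0 ≤ max 0 (min t 2) := le_max_left _ _
    rw [abs_le]; constructor <;> linarith

lemma risk_le_four {S : ℕ} {P Q : Fin S → ℝ} (hP : P ∈ stdSimplex ℝ (Fin S))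
    (hQ : Q ∈ stdSimplex ℝ (Fin S)) : risk c₁ c₂ c₃ n Q P ≤ 4 := by
  refine (integral_mono (integrable_risk c₁ c₂ c₃ n Q P) (integrable_const 4) fun z => ?_).trans
    (by simp)
  have := (abs_clip_sub_le (L1_mem_Icc hP hQ) (preEstimator c₁ c₂ c₃ n Q z.1 z.2)).2
  calc _ ≤ (2 : ℝ) ^ 2 := pow_le_pow_left₀ (abs_nonneg _) this 2
    _ = 4 := by norm_num

/-- If the conditional second moment given a well-classified first half is at most `B`, then the
risk exceeds `B` only by the probability of a misclassification. -/
lemma risk_le_of_good {S : ℕ} {P Q : Fin S → ℝ} (hP : P ∈ stdSimplex ℝ (Fin S))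
    (hQ : Q ∈ stdSimplex ℝ (Fin S)) {G : Fin S → ℕ → Prop} {B δ : ℝ} (hB : 0 ≤ B)
    (hG : ∀ x : Fin S → ℕ, (∀ i, G i (x i)) →
      Integrable (fun y => (preEstimator c₁ c₂ c₃ n Q x y - L1 P Q) ^ 2) (poissonSample n P) ∧
      ∫ y, (preEstimator c₁ c₂ c₃ n Q x y - L1 P Q) ^ 2 ∂(poissonSample n P) ≤ B)
    (hδ : ∀ i, (poissonMeasure (n * P i).toNNReal).real {x | ¬ G i x} ≤ δ) :
    risk c₁ c₂ c₃ n Q P ≤ 4 * (S * δ) + B := by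
  set μ := poissonSample n P with hμ
  set bad : Set (Fin S → ℕ) := ⋃ i, (fun x => x i) ⁻¹' {k | ¬ G i k} with hbad
  have hbadm : MeasurableSet bad := MeasurableSet.of_discrete
  have hbadP : μ.real bad ≤ S * δ := by
    refine (measureReal_iUnion_fintype_le _).trans ((Finset.sum_le_card_nsmul _ _ δ
      fun i _ => ?_).trans_eq (by simp))
    have := (measurePreserving_eval (fun i => poissonMeasure (n * P i).toNNReal) i)
    rw [measureReal_def]
    have h2 := this.measure_preimage (s := {k | ¬ G i k})
      MeasurableSet.of_discrete.nullMeasurableSet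
    exact (congrArg ENNReal.toReal h2).trans_le (hδ i)
  have hint := integrable_risk c₁ c₂ c₃ n Q P
  rw [risk, integral_prod _ hint]
  have hθ := L1_mem_Icc hP hQ
  have hfour : ∀ x y, |estimator c₁ c₂ c₃ n Q x y - L1 P Q| ^ 2 ≤ 4 := fun x y => by
    calc _ ≤ (2 : ℝ) ^ 2 := pow_le_pow_left₀ (abs_nonneg _) (abs_clip_sub_le hθ _).2 2
      _ = 4 := by norm_num
  have hinner : ∀ x, Integrable (fun y => |estimator c₁ c₂ c₃ n Q x y - L1 P Q| ^ 2) μ := fun x =>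
    Integrable.of_bound (C := 4) Measurable.of_discrete.aestronglyMeasurable
      (Filter.Eventually.of_forall fun y => by
        rw [Real.norm_of_nonneg (by positivity)]; exact hfour x y)
  have hle : ∀ x, ∫ y, |estimator c₁ c₂ c₃ n Q x y - L1 P Q| ^ 2 ∂μ
      ≤ bad.indicator (fun _ => (4 : ℝ)) x + B := by
    intro x
    -- The first half is held fixed: on bad outcomes the trivial bound 4 applies, on good ones
    -- clipping is discarded and `B` applies.
    by_cases hx : x ∈ bad
    · rw [Set.indicator_of_mem hx]
      refine (integral_mono (hinner x) (integrable_const 4) (hfour x)).trans ?_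
      simpa using hB
    · rw [Set.indicator_of_notMem hx, zero_add]
      obtain ⟨h1, h2⟩ := hG x fun i => by
        by_contra h
        exact hx (Set.mem_iUnion.2 ⟨i, h⟩)
      refine (integral_mono (hinner x) h1 fun y => ?_).trans h2
      rw [← sq_abs (preEstimator c₁ c₂ c₃ n Q x y - L1 P Q)]
      exact pow_le_pow_left₀ (abs_nonneg _) (abs_clip_sub_le hθ _).1 2
  refine (integral_mono hint.integral_prod_left (((integrable_const (4 : ℝ)).indicator
    hbadm).add (integrable_const B)) hle).trans ?_
  simp only [Pi.add_apply]
  rw [integral_add ((integrable_const (4 : ℝ)).indicator hbadm) (integrable_const B),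
    integral_indicator_const _ hbadm]
  simp only [integral_const, probReal_univ, smul_eq_mul, one_mul]
  linarith

end L1Known

/-! ### Risk bounds and choice of constants -/

namespace L1Known

open MeasureTheory ProbabilityTheory

/-- The risk bound for large samples. -/
theorem risk_le_of_large {c₁ c₂ ε n : ℝ} (hc₁ : 0 < c₁) (hc₂ : 0 < c₂) (hc : c₂ ≤ c₁ / 16)
    (hn : 1 < n) (hn₂ : 2 ≤ c₂ * Real.log n) (hn₁ : 1 ≤ c₁ * Real.log n ^ 2)
    (hlog : 1 ≤ Real.log n) (hε : 0 ≤ ε) (hdeg : (32 : ℝ) ^ deg c₂ n ≤ n ^ ε)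
    {S : ℕ} {Q P : Fin S → ℝ} (hQ : Q ∈ stdSimplex ℝ (Fin S)) (hP : P ∈ stdSimplex ℝ (Fin S)) :
    risk c₁ c₂ (c₁ / 4) n Q P ≤ 4 * (S * (3 * n ^ (-(c₁ / 40))))
      + ((64 * c₂ + 4 * c₁ + 1) * 2 * (Real.log n / n * n ^ ε)
        + ((1 + 32 * √(2 * c₁) / c₂) * ∑ i, min (Q i) (√(Q i / (n * Real.log n)))) ^ 2) := by
  have hn0 : 0 < n := by linarith
  refine risk_le_of_good hP hQ (G := fun i => WellClassified c₁ (c₁ / 4) n (Q i) (P i))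
    (by positivity) (fun x hx => ?_) fun i => poisson_not_wellClassified_le hc₁ hn (hP.1 i)
  have key := fun i => summand_bias_variance hc₁ hc₂ hc (by positivity : 0 ≤ c₁ / 4) hn hn₂ hn₁
    hlog hε hdeg (hQ.1 i) (hP.1 i) (hx i)
  have hdec := integral_sum_sub_sq (μ := fun i => poissonMeasure (n * P i).toNNReal)
    (h := fun i => summand c₁ c₂ (c₁ / 4) n (Q i) (x i)) (fun i => (key i).1) (L1 P Q)
  refine ⟨hdec.1, ?_⟩
  refine hdec.2.trans_le (add_le_add ?_ ?_)
  · refine (Finset.sum_le_sum fun i _ => (key i).2.2).trans_eq ?_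
    rw [← Finset.sum_mul, ← Finset.mul_sum, Finset.sum_add_distrib, hP.2, hQ.2]
    norm_num
  · rw [← sq_abs, L1, ← Finset.sum_sub_distrib, Finset.mul_sum]
    refine pow_le_pow_left₀ (abs_nonneg _) ((Finset.abs_sum_le_sum_abs _ _).trans ?_) 2
    exact Finset.sum_le_sum fun i _ => (key i).2.1

/-- The risk bound for arbitrary sample sizes. -/
theorem exists_risk_le (ε β : ℝ) (hε : 0 < ε) (hβ : 0 < β) :
    ∃ c₁ c₂ c₃ C : ℝ, 0 < c₃ ∧ c₃ < c₁ ∧ 0 < c₂ ∧ c₂ < c₁ ∧ 0 < C ∧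
      ∀ n : ℝ, 1 < n → ∀ (S : ℕ) (Q P : Fin S → ℝ),
        Q ∈ stdSimplex ℝ (Fin S) → P ∈ stdSimplex ℝ (Fin S) →
        risk c₁ c₂ c₃ n Q P ≤
          C * ((∑ i, min (Q i) (√(Q i / (n * Real.log n)))) ^ 2
            + Real.log n / n ^ (1 - ε) + S / n ^ β) := by
  -- This makes the misclassification probability `O(n ^ (-β))`; in `c₂`, the bound `ε / 4` gives
  -- `32 ^ K ≤ n ^ ε` because `32 ≤ e⁴`.
  set c₁ := 40 * β with hc₁d
  set c₂ := min (c₁ / 16) (ε / 4) with hc₂d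
  have hc₁ : 0 < c₁ := by positivity
  have hc₂ : 0 < c₂ := by positivity
  have hc : c₂ ≤ c₁ / 16 := min_le_left _ _
  have hcε : c₂ ≤ ε / 4 := min_le_right _ _
  -- Threshold on `log n` beyond which all the conditions of `risk_le_of_large` hold; each summand
  -- serves one of them.
  set ℓ₀ := 1 + 2 / c₂ + 1 / c₁ with hℓ₀
  have h2c : 0 < 2 / c₂ := by positivity
  have h1c : 0 < 1 / c₁ := by positivity
  set V := (64 * c₂ + 4 * c₁ + 1) * 2 with hV
  set D := 1 + 32 * √(2 * c₁) / c₂ with hD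
  have hV0 : 0 < V := by positivity
  have hD0 : 0 < D := by positivity
  refine ⟨c₁, c₂, c₁ / 4, 4 * Real.exp (β * ℓ₀) + 12 + V + D ^ 2, by positivity, by linarith, hc₂,
    by linarith, by positivity, fun n hn S Q P hQ hP => ?_⟩
  have hn0 : 0 < n := by linarith
  have hl := Real.log_pos hn
  set A := ∑ i, min (Q i) (√(Q i / (n * Real.log n))) with hA
  have hnβ : 0 < n ^ β := Real.rpow_pos_of_pos hn0 β
  have hT2 : 0 ≤ Real.log n / n ^ (1 - ε) := by positivity
  have hT3 : 0 ≤ S / n ^ β := by positivity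
  have hE := Real.exp_pos (β * ℓ₀)
  rcases le_or_gt ℓ₀ (Real.log n) with h | h
  · have hlog : 1 ≤ Real.log n := by linarith
    have hn₂ : 2 ≤ c₂ * Real.log n := by
      rw [← div_le_iff₀' hc₂]; linarith
    have hn₁ : 1 ≤ c₁ * Real.log n ^ 2 := by
      rw [← div_le_iff₀' hc₁]
      nlinarith
    have hdeg : (32 : ℝ) ^ deg c₂ n ≤ n ^ ε := by
      have h32 : (32 : ℝ) ≤ Real.exp 4 := by
        have h1 : (2.7 : ℝ) ≤ Real.exp 1 := by linarith [Real.exp_one_gt_d9]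
        calc (32 : ℝ) ≤ 2.7 ^ 4 := by norm_num
          _ ≤ Real.exp 1 ^ 4 := by gcongr
          _ = Real.exp 4 := by rw [← Real.exp_nat_mul]; norm_num
      have hK : (deg c₂ n : ℝ) ≤ c₂ * Real.log n := Nat.floor_le (by positivity)
      calc (32 : ℝ) ^ deg c₂ n ≤ Real.exp 4 ^ deg c₂ n := by gcongr
        _ = Real.exp (deg c₂ n * 4) := by rw [← Real.exp_nat_mul]
        _ ≤ Real.exp (Real.log n * ε) := Real.exp_le_exp.2 (by nlinarith)
        _ = n ^ ε := by rw [Real.rpow_def_of_pos hn0]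
    have hmain := risk_le_of_large hc₁ hc₂ hc hn hn₂ hn₁ hlog hε.le hdeg hQ hP
    have e1 : Real.log n / n * n ^ ε = Real.log n / n ^ (1 - ε) := by
      rw [Real.rpow_sub hn0, Real.rpow_one]
      field_simp
    have e2 : n ^ (-(c₁ / 40)) = 1 / n ^ β := by
      rw [show c₁ / 40 = β by rw [hc₁d]; ring, Real.rpow_neg hn0.le, one_div]
    rw [e1, e2] at hmain
    have hA2 := sq_nonneg A
    refine hmain.trans ?_
    have e3 : 4 * (S * (3 * (1 / n ^ β))) = 12 * (S / n ^ β) := by ring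
    rw [e3, mul_pow]
    have hD2 : 0 ≤ D ^ 2 := sq_nonneg D
    calc 12 * (S / n ^ β) + (V * (Real.log n / n ^ (1 - ε)) + D ^ 2 * A ^ 2)
        ≤ (4 * Real.exp (β * ℓ₀) + 12 + V + D ^ 2) * (S / n ^ β)
          + ((4 * Real.exp (β * ℓ₀) + 12 + V + D ^ 2) * (Real.log n / n ^ (1 - ε))
          + (4 * Real.exp (β * ℓ₀) + 12 + V + D ^ 2) * A ^ 2) := by
          refine add_le_add ?_ (add_le_add ?_ ?_) <;>
            exact mul_le_mul_of_nonneg_right (by linarith) ‹_›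
      _ = _ := by ring
  -- Below the threshold `n ^ β` is bounded and `S ≥ 1`, since there is no probability vector of
  -- length 0. The term `S / n ^ β` alone then dominates the trivial bound 4.
  · have hS : 1 ≤ S := by
      rcases Nat.eq_zero_or_pos S with rfl | h
      · have := hP.2
        simp at this
      · exact h
    have hS' : (1 : ℝ) ≤ S := by exact_mod_cast hS
    have hnE : n ^ β ≤ Real.exp (β * ℓ₀) := by
      rw [Real.rpow_def_of_pos hn0]
      exact Real.exp_le_exp.2 (by nlinarith)
    refine (risk_le_four hP hQ).trans ?_
    calc (4 : ℝ) = 4 * n ^ β * (1 / n ^ β) := by field_simp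
      _ ≤ 4 * Real.exp (β * ℓ₀) * (S / n ^ β) := by gcongr
      _ ≤ (4 * Real.exp (β * ℓ₀) + 12 + V + D ^ 2) * (A ^ 2 + Real.log n / n ^ (1 - ε)
          + S / n ^ β) := by
        refine mul_le_mul ?_ ?_ hT3 (by positivity)
        · linarith [sq_nonneg D]
        · linarith [sq_nonneg A]

lemma sq_log_le_rpow {n γ : ℝ} (hn : 1 < n) (hγ : 0 < γ) :
    Real.log n ^ 2 ≤ 2 / γ ^ 2 * n ^ γ := by
  have hl := Real.log_pos hn
  have h := Real.quadratic_le_exp_of_nonneg (by positivity : 0 ≤ Real.log n * γ)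
  rw [← Real.rpow_def_of_pos (by linarith)] at h
  have h2 : (Real.log n * γ) ^ 2 / 2 ≤ n ^ γ := by
    have : 0 < Real.log n * γ := by positivity
    linarith
  calc Real.log n ^ 2 = 2 / γ ^ 2 * ((Real.log n * γ) ^ 2 / 2) := by field_simp
    _ ≤ _ := by gcongr

/-- Identifies the functional in the hypothesis of the second claim as a multiple of the one in its
bound. -/
lemma sum_min_eq_sqrt_mul {S : ℕ} {Q : Fin S → ℝ} {t : ℝ} (ht : 0 < t) :
    ∑ i, min (√(Q i)) (Q i * √t) = √t * ∑ i, min (Q i) (√(Q i / t)) := by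
  have hs : 0 < √t := Real.sqrt_pos.2 ht
  rw [Finset.mul_sum]
  refine Finset.sum_congr rfl fun i _ => ?_
  rw [mul_min_of_nonneg _ _ hs.le, Real.sqrt_div' _ ht.le, min_comm, mul_comm (Q i)]
  congr 1
  field_simp

/-- Cauchy–Schwarz, together with `∑ q = 1`. -/
lemma sq_sum_min_le {S : ℕ} {Q : Fin S → ℝ} (hQ : Q ∈ stdSimplex ℝ (Fin S)) {t : ℝ}
    (ht : 0 < t) : (∑ i, min (Q i) (√(Q i / t))) ^ 2 ≤ S / t := by
  calc (∑ i, min (Q i) (√(Q i / t))) ^ 2 ≤ (∑ i, √(Q i / t)) ^ 2 := by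
        refine pow_le_pow_left₀ (Finset.sum_nonneg fun i _ => ?_)
          (Finset.sum_le_sum fun i _ => min_le_right _ _) 2
        exact le_min (hQ.1 i) (Real.sqrt_nonneg _)
    _ ≤ S * ∑ i, √(Q i / t) ^ 2 := by
        simpa using sq_sum_le_card_mul_sum_sq (s := Finset.univ) (f := fun i => √(Q i / t))
    _ = S * ∑ i, Q i / t := by
        congr 1
        exact Finset.sum_congr rfl fun i _ => Real.sq_sqrt (div_nonneg (hQ.1 i) ht.le)
    _ = S / t := by rw [← Finset.sum_div, hQ.2]; ring

/-- Write `A` for the sum in the bound. With `ε = 1 / b` and `r = n ^ (1 / b)` the hypothesis reads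
`r ≤ √(n log n) A`, so `r² ≤ n log n A²`: one factor `r` pays for `n ^ ε`, the other for `log² n`.
With `β = a + 1` the last term is at most `1 / n`. -/
theorem exists_risk_le_of_log_le (a b : ℝ) (ha : 0 < a) (hb : 0 < b) :
    ∃ c₁ c₂ c₃ C : ℝ, 0 < c₃ ∧ c₃ < c₁ ∧ 0 < c₂ ∧ c₂ < c₁ ∧ 0 < C ∧
      ∀ n : ℝ, 1 < n → ∀ (S : ℕ) (Q P : Fin S → ℝ),
        Q ∈ stdSimplex ℝ (Fin S) → P ∈ stdSimplex ℝ (Fin S) →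
        Real.log S ≤ a * Real.log n →
        Real.log n ≤ b * Real.log (∑ i, min (√(Q i)) (Q i * √(n * Real.log n))) →
        risk c₁ c₂ c₃ n Q P ≤ C * (∑ i, min (Q i) (√(Q i / (n * Real.log n)))) ^ 2 := by
  obtain ⟨c₁, c₂, c₃, C, h1, h2, h3, h4, hC, h⟩ :=
    exists_risk_le (1 / b) (a + 1) (by positivity) (by positivity)
  refine ⟨c₁, c₂, c₃, C * (1 + 2 * b ^ 2 + b / 2), h1, h2, h3, h4, by positivity,
    fun n hn S Q P hQ hP hS hlog => (h n hn S Q P hQ hP).trans ?_⟩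
  have hn0 : 0 < n := by linarith
  have hl := Real.log_pos hn
  have hnl : 0 < n * Real.log n := by positivity
  rw [sum_min_eq_sqrt_mul hnl] at hlog
  set A := ∑ i, min (Q i) (√(Q i / (n * Real.log n))) with hA
  have hA0 : 0 ≤ A := Finset.sum_nonneg fun i _ => le_min (hQ.1 i) (Real.sqrt_nonneg _)
  -- A vanishing sum is excluded by the convention `Real.log 0 = 0`, which would force `log n ≤ 0`.
  have hB0 : 0 < √(n * Real.log n) * A := by
    refine lt_of_le_of_ne (by positivity) fun h0 => ?_
    rw [← h0, Real.log_zero, mul_zero] at hlog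
    linarith
  have hB : n ^ (1 / b) ≤ √(n * Real.log n) * A := by
    rw [Real.rpow_def_of_pos hn0, ← Real.le_log_iff_exp_le hB0, mul_one_div, div_le_iff₀' hb]
    exact hlog
  have hA2 : n ^ (1 / b) * n ^ (1 / b) ≤ n * Real.log n * A ^ 2 := by
    have := mul_self_le_mul_self (by positivity) hB
    rwa [← sq (_ * A), mul_pow, Real.sq_sqrt hnl.le] at this
  set r := n ^ (1 / b) with hr
  have hr0 : 0 < r := by positivity
  have hT2 : Real.log n / n ^ (1 - 1 / b) ≤ 2 * b ^ 2 * A ^ 2 := by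
    rw [Real.rpow_sub hn0, Real.rpow_one, ← hr, div_div_eq_mul_div, div_le_iff₀ hn0]
    have h5 := sq_log_le_rpow hn (by positivity : 0 < 1 / b)
    rw [← hr, show 2 / (1 / b) ^ 2 = 2 * b ^ 2 by field_simp] at h5
    have h6 : Real.log n * (Real.log n * r) ≤ Real.log n * (2 * b ^ 2 * A ^ 2 * n) := by
      calc Real.log n * (Real.log n * r) = Real.log n ^ 2 * r := by ring
        _ ≤ 2 * b ^ 2 * r * r := by gcongr
        _ = 2 * b ^ 2 * (r * r) := by ring
        _ ≤ 2 * b ^ 2 * (n * Real.log n * A ^ 2) := by gcongr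
        _ = _ := by ring
    exact le_of_mul_le_mul_left h6 hl
  have hT3 : S / n ^ (a + 1) ≤ b / 2 * A ^ 2 := by
    have hS' : (S : ℝ) ≤ n ^ a := by
      rcases Nat.eq_zero_or_pos S with h0 | h0
      · rw [h0, Nat.cast_zero]; positivity
      · rw [Real.rpow_def_of_pos hn0, ← Real.log_le_iff_le_exp (by exact_mod_cast h0), mul_comm]
        exact hS
    have h7 : Real.log n ≤ b / 2 * (r * r) := by
      have h8 := Real.add_one_le_exp (Real.log n * (1 / b))
      rw [← Real.rpow_def_of_pos hn0, ← hr] at h8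
      have h9 : Real.log n * (1 / b) * b = Real.log n := by field_simp
      have h10 : 2 * (Real.log n * (1 / b)) ≤ r * r := by
        have : 0 < Real.log n * (1 / b) := by positivity
        nlinarith
      nlinarith
    calc S / n ^ (a + 1) ≤ n ^ a / n ^ (a + 1) := by gcongr
      _ = 1 / n := by rw [Real.rpow_add hn0, Real.rpow_one]; field_simp
      _ ≤ b / 2 * A ^ 2 := by
        rw [div_le_iff₀ hn0]
        have h11 : Real.log n * 1 ≤ Real.log n * (b / 2 * A ^ 2 * n) := by
          calc Real.log n * 1 ≤ b / 2 * (r * r) := by linarith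
            _ ≤ b / 2 * (n * Real.log n * A ^ 2) := by gcongr
            _ = _ := by ring
        exact le_of_mul_le_mul_left h11 hl
  calc _ ≤ C * (A ^ 2 + 2 * b ^ 2 * A ^ 2 + b / 2 * A ^ 2) := by gcongr
    _ = _ := by ring

/-- Here `r = n ^ (1 / (2 b))` satisfies `r² ≤ S`; again one factor covers `n ^ ε` and the other
`log² n`, while `β = 2` suffices because `log n ≤ n`. -/
theorem exists_risk_le_card (b : ℝ) (hb : 0 < b) :
    ∃ c₁ c₂ c₃ C : ℝ, 0 < c₃ ∧ c₃ < c₁ ∧ 0 < c₂ ∧ c₂ < c₁ ∧ 0 < C ∧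
      ∀ n : ℝ, 1 < n → ∀ (S : ℕ) (Q P : Fin S → ℝ),
        Q ∈ stdSimplex ℝ (Fin S) → P ∈ stdSimplex ℝ (Fin S) →
        Real.log n ≤ b * Real.log S →
        risk c₁ c₂ c₃ n Q P ≤ C * (S / (n * Real.log n)) := by
  obtain ⟨c₁, c₂, c₃, C, h1, h2, h3, h4, hC, h⟩ :=
    exists_risk_le (1 / (2 * b)) 2 (by positivity) (by positivity)
  refine ⟨c₁, c₂, c₃, C * (2 + 8 * b ^ 2), h1, h2, h3, h4, by positivity,
    fun n hn S Q P hQ hP hlog => (h n hn S Q P hQ hP).trans ?_⟩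
  have hn0 : 0 < n := by linarith
  have hl := Real.log_pos hn
  have hnl : 0 < n * Real.log n := by positivity
  have hA := sq_sum_min_le hQ hnl
  set r := n ^ (1 / (2 * b)) with hr
  have hr0 : 0 < r := by positivity
  have hS0 : (0 : ℝ) < S := by
    rcases Nat.eq_zero_or_pos S with h0 | h0
    · rw [h0, Nat.cast_zero, Real.log_zero] at hlog; linarith
    · exact_mod_cast h0
  have hrS : r * r ≤ S := by
    rw [hr, ← Real.rpow_add hn0, show 1 / (2 * b) + 1 / (2 * b) = 1 / b by field_simp; norm_num,
      Real.rpow_def_of_pos hn0, ← Real.le_log_iff_exp_le hS0, mul_one_div, div_le_iff₀' hb]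
    exact hlog
  have hT2 : Real.log n / n ^ (1 - 1 / (2 * b)) ≤ 8 * b ^ 2 * (S / (n * Real.log n)) := by
    rw [Real.rpow_sub hn0, Real.rpow_one, ← hr, div_div_eq_mul_div, div_le_iff₀ hn0]
    have h5 := sq_log_le_rpow hn (by positivity : 0 < 1 / (2 * b))
    rw [← hr, show 2 / (1 / (2 * b)) ^ 2 = 8 * b ^ 2 by field_simp; norm_num] at h5
    calc Real.log n * r = Real.log n ^ 2 * r / Real.log n := by field_simp
      _ ≤ 8 * b ^ 2 * r * r / Real.log n := by gcongr
      _ = 8 * b ^ 2 * (r * r) / Real.log n := by ring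
      _ ≤ 8 * b ^ 2 * S / Real.log n := by gcongr
      _ = _ := by field_simp
  have hT3 : S / n ^ (2 : ℝ) ≤ S / (n * Real.log n) := by
    rw [Real.rpow_two, sq]
    gcongr
    exact Real.log_le_self hn0.le
  calc _ ≤ C * (S / (n * Real.log n) + 8 * b ^ 2 * (S / (n * Real.log n))
        + S / (n * Real.log n)) := by gcongr
    _ = _ := by ring

end L1Known

theorem theorem2 :
    (∀ ε β : ℝ, 0 < ε → 0 < β →
      ∃ c₁ c₂ c₃ C : ℝ, 0 < c₃ ∧ c₃ < c₁ ∧ 0 < c₂ ∧ c₂ < c₁ ∧ 0 < C ∧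
        ∀ n : ℝ, 1 < n → ∀ (S : ℕ) (Q P : Fin S → ℝ),
          Q ∈ stdSimplex ℝ (Fin S) → P ∈ stdSimplex ℝ (Fin S) →
          L1Known.risk c₁ c₂ c₃ n Q P ≤
            C * ((∑ i, min (Q i) (√(Q i / (n * Real.log n)))) ^ 2
              + Real.log n / n ^ (1 - ε) + S / n ^ β)) ∧
    (∀ a b : ℝ, 0 < a → 0 < b →
      ∃ c₁ c₂ c₃ C : ℝ, 0 < c₃ ∧ c₃ < c₁ ∧ 0 < c₂ ∧ c₂ < c₁ ∧ 0 < C ∧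
        ∀ n : ℝ, 1 < n → ∀ (S : ℕ) (Q P : Fin S → ℝ),
          Q ∈ stdSimplex ℝ (Fin S) → P ∈ stdSimplex ℝ (Fin S) →
          Real.log S ≤ a * Real.log n →
          Real.log n ≤ b * Real.log (∑ i, min (√(Q i)) (Q i * √(n * Real.log n))) →
          L1Known.risk c₁ c₂ c₃ n Q P ≤
            C * (∑ i, min (Q i) (√(Q i / (n * Real.log n)))) ^ 2) ∧
    (∀ b : ℝ, 0 < b →
      ∃ c₁ c₂ c₃ C : ℝ, 0 < c₃ ∧ c₃ < c₁ ∧ 0 < c₂ ∧ c₂ < c₁ ∧ 0 < C ∧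
        ∀ n : ℝ, 1 < n → ∀ (S : ℕ) (Q P : Fin S → ℝ),
          Q ∈ stdSimplex ℝ (Fin S) → P ∈ stdSimplex ℝ (Fin S) →
          Real.log n ≤ b * Real.log S →
          L1Known.risk c₁ c₂ c₃ n Q P ≤ C * (S / (n * Real.log n))) :=
  ⟨L1Known.exists_risk_le, L1Known.exists_risk_le_of_log_le, L1Known.exists_risk_le_card⟩
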